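/- Let $S^1$ be the unit circle, let $\sigma$ be a uniform measure on $S^1$ (a rotation-invariant Borel measure with $0<\sigma(S^1)<\infty$, e.g. arc length), and let $\lambda>\mu>0$. Let $\mathbb M(S^1)$ be the space of (finite) simple point measures on $S^1$, with the $\sigma$-algebra generated by the maps $\nu\mapsto\nu(B)$, $B\subseteq S^1$ Borel. For a rotation $\theta$ of $S^1$ write $\theta(\nu)(A):=\nu(\theta^{-1}(A))$, and call $f:\mathbb M(S^1)\to\mathbb M(S^1)$ rotation-equivariant if $\theta(f(\nu))=f(\theta(\nu))$ for all $\nu\in\mathbb M(S^1)$ and all rotations $\theta$. A homogeneous Poisson process of intensity $\lambda$ on $S^1$ is a Poisson point process with intensity measure $\lambda\sigma$. Let $\Pi$ be a homogeneous Poisson process of intensity $\lambda$ on $S^1$, and let $X$ and $Y$ be Poisson random variables with respective means $\lambda\,\sigma(S^1)$ and $\mu\,\sigma(S^1)$. Then the following are equivalent. (i) There exists a measurable, rotation-equivariant function $f:\mathbb M(S^1)\to\mathbb M(S^1)$ such that $f(\Pi)$ is a homogeneous Poisson process of intensity $\mu$ on $S^1$, and almost surely every point of $f(\Pi)$ is a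 point of $\Pi$. (ii) There exists an integer $k\ge 0$ such that $\mathbb P(X=k)\le \mathbb P(Y=k)$ and $\mathbb P(X\le k+1)\le \mathbb P(Y\le k)$. (iii) There is no integer $k\ge 0$ such that $\mathbb P(X=k+1)>\mathbb P(Y=k+1)$ and $\mathbb P(X\le k+1)>\mathbb P(Y\le k)$. -/

import Mathlib

open MeasureTheory ProbabilityTheory
open scoped NNReal ENNReal

/-- The Borel σ-algebra on the unit circle `S¹ = {z : ℂ | ‖z‖ = 1}`. -/
noncomputable instance Circle.instMeasurableSpaceBorel : MeasurableSpace Circle := borel Circle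

instance Circle.instBorelSpaceBorel : BorelSpace Circle := ⟨rfl⟩

/-- `ν` is a (finite) simple point measure: a finite sum of unit masses at distinct points. -/
def IsSimplePointMeasure {S : Type*} [MeasurableSpace S] (ν : Measure S) : Prop :=
  ∃ A : Finset S, ν = ∑ x ∈ A, Measure.dirac x

/-- The space `𝕄(S)` of simple point measures on `S`. As a subtype of `Measure S` it carries
the σ-algebra generated by the evaluations `ν ↦ ν B`, `B` measurable. -/
abbrev SimplePointMeasure (S : Type*) [MeasurableSpace S] : Type _ :=
  {ν : Measure S // IsSimplePointMeasure ν}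

/-- The set `[ν] = {x | ν {x} = 1}` of points of a simple point measure. -/
def SimplePointMeasure.points {S : Type*} [MeasurableSpace S] (ν : SimplePointMeasure S) :
    Set S :=
  {x | ν.1 {x} = 1}

/-- The random element `ξ` of `𝕄(S)`, defined on the probability space `(Ω, P)`, is a Poisson
point process with finite intensity measure `m`: the number of points in each measurable set `B`
is a Poisson variable with mean `m B`, and the numbers of points in finitely many pairwise
disjoint measurable sets are independent. -/
structure IsPoissonProcess {Ω S : Type*} [MeasurableSpace Ω] [MeasurableSpace S]
    (P : Measure Ω) (m : Measure S) [IsFiniteMeasure m] (ξ : Ω → SimplePointMeasure S) :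
    Prop where
  measurable : Measurable ξ
  law_count : ∀ B : Set S, MeasurableSet B → ∀ n : ℕ,
    P {ω | (ξ ω).1 B = (n : ℝ≥0∞)} = poissonMeasure (m B).toNNReal {n}
  indep : ∀ (n : ℕ) (B : Fin n → Set S), (∀ i, MeasurableSet (B i)) →
    Pairwise (fun i j => Disjoint (B i) (B j)) →
    iIndepFun (fun (i : Fin n) (ω : Ω) => (ξ ω).1 (B i)) P

theorem IsSimplePointMeasure.map_rotation {ν : Measure Circle} (hν : IsSimplePointMeasure ν)
    (θ : Circle) : IsSimplePointMeasure (ν.map (fun x => θ * x)) := by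
  classical
  obtain ⟨A, rfl⟩ := hν
  have hm : Measurable (fun x : Circle => θ * x) :=
    (continuous_const.mul continuous_id).measurable
  refine ⟨A.image (fun x => θ * x), ?_⟩
  rw [Finset.sum_image (fun x _ y _ h => mul_left_cancel h),
    ← Measure.mapₗ_apply_of_measurable hm, map_sum]
  exact Finset.sum_congr rfl fun x _ => by
    rw [Measure.mapₗ_apply_of_measurable hm, Measure.map_dirac' hm]

/-- The rotation of `S¹` by `θ`, acting on simple point measures: `θ(ν)(A) = ν(θ⁻¹(A))`. -/
noncomputable def SimplePointMeasure.rotate (θ : Circle) (ν : SimplePointMeasure Circle) :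
    SimplePointMeasure Circle :=
  ⟨ν.1.map (fun x => θ * x), ν.2.map_rotation θ⟩

/-- `f : 𝕄(S¹) → 𝕄(S¹)` commutes with all rotations of the circle. -/
def IsRotationEquivariant (f : SimplePointMeasure Circle → SimplePointMeasure Circle) : Prop :=
  ∀ (ν : SimplePointMeasure Circle) (θ : Circle), (f ν).rotate θ = f (ν.rotate θ)

/-!
Conditionally on its number of points, a Poisson process is an i.i.d. uniform sample, so the theorem
is about coupling the Poisson numbers of points `X` and `Y`.

Suppose that `P(Y = n) < P(X = n)` and that `f` fixed the configurations of `n` points in a set of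
positive probability under the sample of size `n`. Then `f(Π)` would lie in this set at least as
often as `Π`, although the probabilities have the ratio `P(Y = n) / P(X = n) < 1`. Hence `f` deletes
a point from almost every configuration of `n` points, so that `X ≤ n` forces `Y < n`.

Conversely, the randomness needed to thin `Π` must be extracted from `Π` without breaking the
rotational symmetry. Call a point of a configuration of `n` points removable if, for `1 ≤ j < n`, at
least `j` of the other points lie within `j / n` turns after it. By a cycle lemma every
configuration has a removable point; on the other hand, given `n - 1` points, at most one of the `n`
rotations of an additional point by multiples of `1 / n` turn is removable. Averaging over these
rotations shows that almost surely there is exactly one removable point and that deleting it leaves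
an i.i.d. uniform sample of size `n - 1`. The `n`-th power of the product of the quotients of the
remaining points by the deleted one does not distinguish these `n` rotations. For `n ≥ 2` it is
therefore a rotation-invariant uniform mark, independent of what is left. The mark decides how many
further points to delete, through a coupling of `X` and `Y` by quantile functions in which the
values of `X` up to `k` are left unchanged.
-/

universe u

section SimplePointMeasure

variable {S : Type u} [MeasurableSpace S]

namespace SimplePointMeasure

theorem measurable_eval {B : Set S} (hB : MeasurableSet B) :
    Measurable fun ν : SimplePointMeasure S => ν.1 B :=
  (Measure.measurable_coe hB).comp measurable_subtype_coe

theorem measurable_of_eval {α : Type*} [MeasurableSpace α] {f : α → SimplePointMeasure S}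
    (hf : ∀ B, MeasurableSet B → Measurable fun a => (f a).1 B) : Measurable f :=
  Measurable.subtype_mk (Measure.measurable_of_measurable_coe _ hf)

theorem exists_nat_eq (ν : SimplePointMeasure S) {B : Set S} (hB : MeasurableSet B) :
    ∃ n : ℕ, ν.1 B = n := by
  classical
  obtain ⟨_, A, rfl⟩ := ν
  refine ⟨(A.filter (· ∈ B)).card, ?_⟩
  simp [Measure.finsetSum_apply, Measure.dirac_apply' _ hB, Set.indicator_apply]

instance (ν : SimplePointMeasure S) : IsFiniteMeasure ν.1 :=
  ⟨by obtain ⟨n, hn⟩ := ν.exists_nat_eq .univ; rw [hn]; exact ENNReal.natCast_lt_top n⟩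

/-- The number of points of `ν` in `B` as a natural number, for measurable `B`. -/
noncomputable def count (ν : SimplePointMeasure S) (B : Set S) : ℕ := ⌊(ν.1 B).toReal⌋₊

theorem natCast_count (ν : SimplePointMeasure S) {B : Set S} (hB : MeasurableSet B) :
    (ν.count B : ℝ≥0∞) = ν.1 B := by
  obtain ⟨n, hn⟩ := ν.exists_nat_eq hB
  simp [count, hn]

theorem count_eq_iff (ν : SimplePointMeasure S) {B : Set S} (hB : MeasurableSet B) {n : ℕ} :
    ν.count B = n ↔ ν.1 B = n := by
  rw [← ν.natCast_count hB, Nat.cast_inj]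

theorem measurable_count {B : Set S} (hB : MeasurableSet B) :
    Measurable fun ν : SimplePointMeasure S => ν.count B :=
  Nat.measurable_floor.comp (measurable_eval hB).ennreal_toReal

theorem exists_eval_preimage_eq {s : Set (SimplePointMeasure S)} (hs : MeasurableSet s) :
    ∃ t, MeasurableSet t ∧
      (fun (ν : SimplePointMeasure S) (B : {B : Set S // MeasurableSet B}) => ν.1 B.1) ⁻¹' t = s :=
  let e (ν : SimplePointMeasure S) (B : {B : Set S // MeasurableSet B}) := ν.1 B.1
  have hid : @Measurable _ _ (MeasurableSpace.comap e MeasurableSpace.pi) _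
      (id : SimplePointMeasure S → SimplePointMeasure S) :=
    @measurable_of_eval S _ _ (MeasurableSpace.comap e MeasurableSpace.pi) _ fun B hB =>
      (measurable_pi_apply (⟨B, hB⟩ : {B : Set S // MeasurableSet B})).comp (comap_measurable e)
  hid hs

theorem measure_ext_of_map_eval {R R' : Measure (SimplePointMeasure S)} [IsFiniteMeasure R]
    (h : ∀ (ι : Type u) [Finite ι] (B : ι → Set S), (∀ i, MeasurableSet (B i)) →
      R.map (fun ν i => ν.1 (B i)) = R'.map (fun ν i => ν.1 (B i))) : R = R' := by
  let e : SimplePointMeasure S → {B : Set S // MeasurableSet B} → ℝ≥0∞ := fun ν B => ν.1 B.1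
  have he : Measurable e := measurable_pi_lambda _ fun B => measurable_eval B.2
  have hmap : R.map e = R'.map e := by
    refine IsProjectiveLimit.unique (P := fun I => (R.map e).map I.restrict)
      (fun _ => rfl) fun I => ?_
    change (R'.map e).map I.restrict = (R.map e).map I.restrict
    rw [Measure.map_map I.measurable_restrict he, Measure.map_map I.measurable_restrict he]
    exact (h I (fun B => B.1.1) fun B => B.1.2).symm
  ext s hs
  obtain ⟨t, ht, rfl⟩ := exists_eval_preimage_eq hs
  rw [← Measure.map_apply he ht, ← Measure.map_apply he ht, hmap]

/-- The atom `{x | ∀ i, x ∈ B i ↔ i ∈ J}` of a family of sets `B`: distinct atoms are disjoint,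
and every `B i` is a union of atoms. -/
def atom {ι : Type*} (B : ι → Set S) (J : Set ι) : Set S := (fun x => {i | x ∈ B i}) ⁻¹' {J}

theorem measurableSet_atom {ι : Type*} [Countable ι] {B : ι → Set S}
    (hB : ∀ i, MeasurableSet (B i)) (J : Set ι) : MeasurableSet (atom B J) :=
  measurable_set_iff.2 (fun i => measurable_mem.2 (hB i)) (measurableSet_singleton J)

open Classical in
theorem measure_eq_sum_atom {ι : Type*} [Fintype ι] {B : ι → Set S}
    (hB : ∀ i, MeasurableSet (B i)) (ν : Measure S) (i : ι) :
    ν (B i) = ∑ J : Set ι with i ∈ J, ν (atom B J) := by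
  unfold atom
  rw [sum_measure_preimage_singleton _ fun J _ => measurableSet_atom hB J]
  congr 1
  ext x
  simp

/-- Disjoint sets suffice because every finite family is a function of its atoms. -/
theorem measure_ext_of_map_eval_disjoint {R R' : Measure (SimplePointMeasure S)} [IsFiniteMeasure R]
    (h : ∀ (ι : Type u) [Fintype ι] (B : ι → Set S), (∀ i, MeasurableSet (B i)) →
      Pairwise (fun i j => Disjoint (B i) (B j)) →
      R.map (fun ν i => ν.1 (B i)) = R'.map (fun ν i => ν.1 (B i))) : R = R' := by
  classical
  refine measure_ext_of_map_eval fun ι _ B hB => ?_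
  have := Fintype.ofFinite ι
  let g : (Set ι → ℝ≥0∞) → ι → ℝ≥0∞ := fun v i => ∑ J : Set ι with i ∈ J, v J
  have hg : Measurable g :=
    measurable_pi_lambda _ fun i => Finset.measurable_fun_sum _ fun J _ => measurable_pi_apply J
  have hfactor : (fun (ν : SimplePointMeasure S) i => ν.1 (B i)) = g ∘ fun ν J => ν.1 (atom B J) :=
    funext fun ν => funext fun i => measure_eq_sum_atom hB ν.1 i
  have hatom : Measurable fun (ν : SimplePointMeasure S) J => ν.1 (atom B J) :=
    measurable_pi_lambda _ fun J => measurable_eval (measurableSet_atom hB J)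
  rw [hfactor, ← Measure.map_map hg hatom, ← Measure.map_map hg hatom,
    h _ _ (measurableSet_atom hB) (pairwise_disjoint_fiber _)]

end SimplePointMeasure

namespace IsPoissonProcess

variable {Ω Ω' : Type*} [MeasurableSpace Ω] [MeasurableSpace Ω']
  {P : Measure Ω} {P' : Measure Ω'} {m : Measure S} [IsFiniteMeasure m]
  {ξ : Ω → SimplePointMeasure S} {ξ' : Ω' → SimplePointMeasure S}

theorem congr {m' : Measure S} [IsFiniteMeasure m'] (h : IsPoissonProcess P m ξ) (hm : m = m') :
    IsPoissonProcess P m' ξ := by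
  subst hm
  exact h

theorem measurable_eval (h : IsPoissonProcess P m ξ) {B : Set S} (hB : MeasurableSet B) :
    Measurable fun ω => (ξ ω).1 B :=
  (SimplePointMeasure.measurable_eval hB).comp h.measurable

theorem measurable_count (h : IsPoissonProcess P m ξ) {B : Set S} (hB : MeasurableSet B) :
    Measurable fun ω => (ξ ω).count B :=
  (SimplePointMeasure.measurable_count hB).comp h.measurable

theorem map_count (h : IsPoissonProcess P m ξ) {B : Set S} (hB : MeasurableSet B) :
    P.map (fun ω => (ξ ω).count B) = poissonMeasure (m B).toNNReal := by
  refine Measure.ext_of_singleton fun n => ?_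
  rw [Measure.map_apply (h.measurable_count hB) (measurableSet_singleton n), ← h.law_count B hB n]
  simp only [Set.preimage, Set.mem_singleton_iff, SimplePointMeasure.count_eq_iff _ hB]

theorem map_eval (h : IsPoissonProcess P m ξ) {B : Set S} (hB : MeasurableSet B) :
    P.map (fun ω => (ξ ω).1 B) = (poissonMeasure (m B).toNNReal).map (Nat.cast : ℕ → ℝ≥0∞) := by
  rw [← h.map_count hB, Measure.map_map .of_discrete (h.measurable_count hB)]
  simp only [Function.comp_def, SimplePointMeasure.natCast_count _ hB]

theorem iIndepFun_eval (h : IsPoissonProcess P m ξ) {ι : Type*} [Finite ι] {B : ι → Set S}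
    (hB : ∀ i, MeasurableSet (B i)) (hd : Pairwise fun i j => Disjoint (B i) (B j)) :
    iIndepFun (fun i ω => (ξ ω).1 (B i)) P := by
  obtain ⟨n, ⟨e⟩⟩ := Finite.exists_equiv_fin ι
  have := h.indep n (fun i => B (e.symm i)) (fun i => hB _)
    fun i j hij => hd (e.symm.injective.ne hij)
  simpa only [Equiv.symm_apply_apply] using this.precomp e.injective

theorem map_eval_pi (h : IsPoissonProcess P m ξ) {ι : Type*} [Fintype ι] {B : ι → Set S}
    (hB : ∀ i, MeasurableSet (B i)) (hd : Pairwise fun i j => Disjoint (B i) (B j)) :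
    P.map (fun ω i => (ξ ω).1 (B i)) =
      Measure.pi fun i => (poissonMeasure (m (B i)).toNNReal).map (Nat.cast : ℕ → ℝ≥0∞) := by
  have hind := h.iIndepFun_eval hB hd
  have := hind.isProbabilityMeasure
  rw [(iIndepFun_iff_map_fun_eq_pi_map fun i =>
    (h.measurable_eval (hB i)).aemeasurable).1 hind]
  simp only [h.map_eval (hB _)]

theorem map_eq_map [IsFiniteMeasure P] (h : IsPoissonProcess P m ξ)
    (h' : IsPoissonProcess P' m ξ') : P.map ξ = P'.map ξ' := by
  refine SimplePointMeasure.measure_ext_of_map_eval_disjoint fun ι _ B hB hd => ?_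
  have heval : Measurable fun (ν : SimplePointMeasure S) i => ν.1 (B i) :=
    measurable_pi_lambda _ fun i => SimplePointMeasure.measurable_eval (hB i)
  rw [Measure.map_map heval h.measurable, Measure.map_map heval h'.measurable]
  exact (h.map_eval_pi hB hd).trans (h'.map_eval_pi hB hd).symm

end IsPoissonProcess

end SimplePointMeasure

section MixedBinomial

theorem cexp_sum_indicator_mul_I {α ι : Type*} [Fintype ι] {B : ι → Set α}
    (hd : Pairwise fun i j => Disjoint (B i) (B j)) (t : ι → ℝ) (y : α) :
    Complex.exp ((∑ i, (B i).indicator 1 y * t i : ℝ) * Complex.I) =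
      1 + ∑ i, (B i).indicator 1 y * (Complex.exp (t i * Complex.I) - 1) := by
  by_cases hy : ∃ i, y ∈ B i
  · obtain ⟨i, hi⟩ := hy
    have hne : ∀ j, j ≠ i → y ∉ B j := fun j hj hyj => Set.disjoint_left.1 (hd hj) hyj hi
    rw [Finset.sum_eq_single i (fun j _ hj => by simp [hne j hj]) (by simp),
      Finset.sum_eq_single i (fun j _ hj => by simp [hne j hj]) (by simp)]
    simp [hi]
  · push Not at hy
    simp [hy]

variable {S : Type*} [MeasurableSpace S]

theorem isSimplePointMeasure_zero : IsSimplePointMeasure (0 : Measure S) := ⟨∅, by simp⟩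

theorem isSimplePointMeasure_sum_dirac {n : ℕ} {x : Fin n → S} (hx : Function.Injective x) :
    IsSimplePointMeasure (∑ i, Measure.dirac (x i)) :=
  ⟨Finset.univ.map ⟨x, hx⟩, by simp⟩

open Classical in
/-- The simple point measure with points `x 0, …, x (n - 1)`. If these are not distinct, the value
is the zero measure. -/
noncomputable def SimplePointMeasure.ofFn {n : ℕ} (x : Fin n → S) : SimplePointMeasure S :=
  if hx : Function.Injective x then ⟨_, isSimplePointMeasure_sum_dirac hx⟩
  else ⟨0, isSimplePointMeasure_zero⟩

theorem SimplePointMeasure.ofFn_apply {n : ℕ} {x : Fin n → S} (hx : Function.Injective x) :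
    (ofFn x).1 = ∑ i, Measure.dirac (x i) := by
  simp [ofFn, hx]

/-- The law of the point process formed by `n` independent points with law `U`. -/
noncomputable def binomialLaw (U : Measure S) (n : ℕ) : Measure (SimplePointMeasure S) :=
  (Measure.pi fun _ : Fin n => U).map SimplePointMeasure.ofFn

/-- The law of the point process formed by a Poisson number of independent points with law `U`,
the mean number being `a`. -/
noncomputable def poissonMixture (U : Measure S) (a : ℝ≥0) : Measure (SimplePointMeasure S) :=
  (poissonMeasure a).bind (binomialLaw U)

theorem poissonMixture_apply (U : Measure S) (a : ℝ≥0) {s : Set (SimplePointMeasure S)}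
    (hs : MeasurableSet s) :
    poissonMixture U a s = ∫⁻ n, binomialLaw U n s ∂poissonMeasure a :=
  Measure.bind_apply hs .of_discrete

section Injective

variable [MeasurableEq S]

theorem measurableSet_injective (n : ℕ) :
    MeasurableSet {x : Fin n → S | Function.Injective x} := by
  have hset : {x : Fin n → S | Function.Injective x} =
      ⋂ (i) (j) (_ : i ≠ j), {x | x i = x j}ᶜ := by
    ext x
    simp only [Set.mem_ofPred_eq, Set.mem_iInter, Set.mem_compl_iff]
    exact Function.injective_iff_pairwise_ne
  rw [hset]
  exact .iInter fun i => .iInter fun j => .iInter fun _ =>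
    (measurableSet_eq_fun (measurable_pi_apply i) (measurable_pi_apply j)).compl

theorem SimplePointMeasure.measurable_ofFn (n : ℕ) :
    Measurable (ofFn : (Fin n → S) → SimplePointMeasure S) := by
  classical
  refine measurable_of_eval fun B hB => ?_
  have hval : (fun x : Fin n → S => (ofFn x).1 B) = fun x =>
      if Function.Injective x then ∑ i, B.indicator 1 (x i) else 0 := by
    ext x
    by_cases hx : Function.Injective x
    · simp [ofFn_apply hx, hx, Measure.finsetSum_apply, Measure.dirac_apply' _ hB]
    · simp [ofFn, hx]
  rw [hval]
  exact (Finset.measurable_fun_sum _ fun i _ =>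
    (measurable_one.indicator hB).comp (measurable_pi_apply i)).ite
      (measurableSet_injective n) measurable_const

variable (U : Measure S) [IsProbabilityMeasure U]

instance (n : ℕ) : IsProbabilityMeasure (binomialLaw U n) :=
  Measure.isProbabilityMeasure_map (SimplePointMeasure.measurable_ofFn n).aemeasurable

instance (a : ℝ≥0) : IsProbabilityMeasure (poissonMixture U a) :=
  isProbabilityMeasure_bind .of_discrete (.of_forall fun _ => inferInstance)

variable [NullSingletonClass U]

theorem ae_ne_prod : ∀ᵐ p ∂U.prod U, p.1 ≠ p.2 := by
  refine measure_eq_zero_iff_ae_notMem.1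
    ((Measure.measure_prod_null (measurableSet_diagonal (α := S))).2 (.of_forall fun x => ?_))
  have hslice : Prod.mk x ⁻¹' Set.diagonal S = {x} := by ext; simp [eq_comm]
  simp [hslice]

theorem ae_injective_pi (n : ℕ) :
    ∀ᵐ x ∂Measure.pi fun _ : Fin n => U, Function.Injective x := by
  simp only [Function.injective_iff_pairwise_ne, Pairwise, ae_all_iff]
  intro i j hij
  have hpair : (Measure.pi fun _ : Fin n => U).map (fun x => (x i, x j)) = U.prod U := by
    have hind := (iIndepFun_pi (μ := fun _ : Fin n => U) (X := fun _ => id)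
      fun _ => aemeasurable_id).indepFun hij
    have hmap := (indepFun_iff_map_prod_eq_prod_map_map (measurable_pi_apply i).aemeasurable
      (measurable_pi_apply j).aemeasurable).1 hind
    simpa [(measurePreserving_eval (fun _ : Fin n => U) _).map_eq] using hmap
  have hne := ae_ne_prod U
  rw [← hpair] at hne
  exact ae_of_ae_map (f := fun x : Fin n → S => (x i, x j)) (by fun_prop) hne

end Injective

namespace SimplePointMeasure

variable {ι : Type*} [Fintype ι] {B : ι → Set S}

/-- The integrand `exp (i ∑ j, t j * ν (B j))` of the characteristic function of the numbers of
points in the sets `B j`. -/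
noncomputable def countPhase (B : ι → Set S) (t : ι → ℝ) (ν : SimplePointMeasure S) : ℂ :=
  Complex.exp ((∑ i, (ν.1 (B i)).toReal * t i : ℝ) * Complex.I)

theorem measurable_countPhase (hB : ∀ i, MeasurableSet (B i)) (t : ι → ℝ) :
    Measurable (countPhase B t) := by
  have hsum : Measurable fun ν : SimplePointMeasure S => ∑ i, (ν.1 (B i)).toReal * t i :=
    Finset.measurable_fun_sum _ fun i _ => (measurable_eval (hB i)).ennreal_toReal.mul_const _
  exact Complex.measurable_exp.comp ((Complex.measurable_ofReal.comp hsum).mul_const _)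

theorem integrable_countPhase (hB : ∀ i, MeasurableSet (B i)) (t : ι → ℝ)
    (R : Measure (SimplePointMeasure S)) [IsFiniteMeasure R] : Integrable (countPhase B t) R :=
  .of_bound (measurable_countPhase hB t).aestronglyMeasurable 1
    (.of_forall fun _ => (Complex.norm_exp_ofReal_mul_I _).le)

theorem countPhase_ofFn (hB : ∀ i, MeasurableSet (B i)) (t : ι → ℝ) {n : ℕ} {x : Fin n → S}
    (hx : Function.Injective x) :
    countPhase B t (ofFn x) =
      ∏ l, Complex.exp ((∑ i, (B i).indicator 1 (x l) * t i : ℝ) * Complex.I) := by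
  have hcount : ∀ i, ((ofFn x).1 (B i)).toReal = ∑ l, (B i).indicator 1 (x l) := fun i => by
    simp only [ofFn_apply hx, Measure.finsetSum_apply, Measure.dirac_apply' _ (hB i)]
    rw [ENNReal.toReal_sum fun l _ => by by_cases h : x l ∈ B i <;> simp [h]]
    exact Finset.sum_congr rfl fun l _ => by by_cases h : x l ∈ B i <;> simp [h]
  rw [countPhase, ← Complex.exp_sum, ← Finset.sum_mul, ← Complex.ofReal_sum, Finset.sum_comm]
  simp only [hcount, Finset.sum_mul]

end SimplePointMeasure

section CharacteristicFunction

variable {ι : Type*} [Fintype ι] {B : ι → Set S}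

theorem integral_cexp_sum_indicator_mul_I (U : Measure S) [IsProbabilityMeasure U]
    (hB : ∀ i, MeasurableSet (B i)) (hd : Pairwise fun i j => Disjoint (B i) (B j)) (t : ι → ℝ) :
    ∫ y, Complex.exp ((∑ i, (B i).indicator 1 y * t i : ℝ) * Complex.I) ∂U =
      1 + ∑ i, U.real (B i) * (Complex.exp (t i * Complex.I) - 1) := by
  have hinteg : ∀ i, Integrable
      (fun y => (B i).indicator 1 y * (Complex.exp (t i * Complex.I) - 1)) U := fun i =>
    ((integrable_const (1 : ℂ)).indicator (hB i)).mul_const _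
  simp only [cexp_sum_indicator_mul_I hd]
  rw [integral_add (integrable_const _) (integrable_finsetSum _ fun i _ => hinteg i),
    integral_finsetSum _ fun i _ => hinteg i]
  congr 1
  · simp
  · refine Finset.sum_congr rfl fun i _ => ?_
    rw [integral_mul_const]
    congr 1
    rw [integral_indicator (hB i)]
    simp

theorem integral_pow_poissonMeasure (a : ℝ≥0) (z : ℂ) :
    ∫ n, z ^ n ∂poissonMeasure a = Complex.exp (a * (z - 1)) := by
  have hseries := (NormedSpace.expSeries_div_hasSum_exp ((a : ℂ) * z)).mul_left (Complex.exp (-a))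
  rw [← Complex.exp_eq_exp_ℂ, ← Complex.exp_add] at hseries
  rw [integral_poissonMeasure, show (a * (z - 1) : ℂ) = -a + a * z by ring, ← hseries.tsum_eq]
  congr 1
  ext n
  rw [Complex.real_smul]
  push_cast
  ring

variable [MeasurableEq S] (U : Measure S) [IsProbabilityMeasure U] [NullSingletonClass U]

theorem integral_countPhase_binomialLaw (hB : ∀ i, MeasurableSet (B i))
    (hd : Pairwise fun i j => Disjoint (B i) (B j)) (t : ι → ℝ) (n : ℕ) :
    ∫ ν, SimplePointMeasure.countPhase B t ν ∂binomialLaw U n =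
      (1 + ∑ i, U.real (B i) * (Complex.exp (t i * Complex.I) - 1)) ^ n := by
  rw [binomialLaw, integral_map (SimplePointMeasure.measurable_ofFn n).aemeasurable
    (SimplePointMeasure.measurable_countPhase hB t).aestronglyMeasurable,
    integral_congr_ae ((ae_injective_pi U n).mono fun x hx =>
      SimplePointMeasure.countPhase_ofFn hB t hx),
    integral_fintype_prod_eq_pow
      (fun y => Complex.exp ((∑ i, (B i).indicator 1 y * t i : ℝ) * Complex.I)),
    integral_cexp_sum_indicator_mul_I U hB hd, Fintype.card_fin]

theorem integral_countPhase_poissonMixture (a : ℝ≥0) (hB : ∀ i, MeasurableSet (B i))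
    (hd : Pairwise fun i j => Disjoint (B i) (B j)) (t : ι → ℝ) :
    ∫ ν, SimplePointMeasure.countPhase B t ν ∂poissonMixture U a =
      ∏ i, Complex.exp ((a • U).real (B i) * (Complex.exp (t i * Complex.I) - 1)) := by
  have hbind : ∫ ν, SimplePointMeasure.countPhase B t ν ∂poissonMixture U a =
      ∫ n, ∫ ν, SimplePointMeasure.countPhase B t ν ∂binomialLaw U n ∂poissonMeasure a := by
    have hinteg := SimplePointMeasure.integrable_countPhase hB t (poissonMixture U a)
    have hcomp : poissonMixture U a =
        (Kernel.ofFunOfCountable (binomialLaw U) ∘ₖ Kernel.const Unit (poissonMeasure a)) () :=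
      Measure.comp_eq_comp_const_apply (κ := Kernel.ofFunOfCountable (binomialLaw U))
    rw [hcomp] at hinteg ⊢
    rw [Kernel.integral_comp hinteg]
    rfl
  simp only [hbind, integral_countPhase_binomialLaw U hB hd, integral_pow_poissonMeasure,
    add_sub_cancel_left, ← Complex.exp_sum, Finset.mul_sum]
  congr 2
  ext i
  rw [measureReal_nnreal_smul_apply]
  push_cast
  ring

end CharacteristicFunction

section OfCharacteristicFunction

variable {Ω : Type*} [MeasurableSpace Ω] {P : Measure Ω}
  {ξ : Ω → SimplePointMeasure S}

theorem charFun_map_eval_toReal (hξ : Measurable ξ) {B : Set S} (hB : MeasurableSet B) (t : ℝ) :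
    charFun (P.map fun ω => ((ξ ω).1 B).toReal) t =
      ∫ ω, SimplePointMeasure.countPhase (fun _ : Fin 1 => B) (fun _ => t) (ξ ω) ∂P := by
  have heval : Measurable fun ω => ((ξ ω).1 B).toReal :=
    ((SimplePointMeasure.measurable_eval hB).comp hξ).ennreal_toReal
  rw [charFun_apply, integral_map heval.aemeasurable (by fun_prop)]
  simp only [Real.inner_apply, SimplePointMeasure.countPhase, Fin.sum_univ_one]

variable [IsProbabilityMeasure P]

theorem measure_eval_eq_of_charFun (hξ : Measurable ξ) {B : Set S} (hB : MeasurableSet B) {a : ℝ≥0}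
    (h : ∀ t, charFun (P.map fun ω => ((ξ ω).1 B).toReal) t =
      Complex.exp (a * (Complex.exp (t * Complex.I) - 1))) (n : ℕ) :
    P {ω | (ξ ω).1 B = n} = poissonMeasure a {n} := by
  have heval : Measurable fun ω => ((ξ ω).1 B).toReal :=
    ((SimplePointMeasure.measurable_eval hB).comp hξ).ennreal_toReal
  have := Measure.isProbabilityMeasure_map (μ := P) heval.aemeasurable
  have hlaw : P.map (fun ω => ((ξ ω).1 B).toReal) = (poissonMeasure a).map (Nat.cast : ℕ → ℝ) :=
    Measure.ext_of_charFun (funext fun t => by rw [h, charFun_map_cast_poissonMeasure])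
  have hpoint := congrArg (fun R => R {(n : ℝ)}) hlaw
  rw [Measure.map_apply heval (measurableSet_singleton _),
    Measure.map_apply .of_discrete (measurableSet_singleton _)] at hpoint
  convert! hpoint using 2
  · ext ω
    obtain ⟨k, hk⟩ := (ξ ω).exists_nat_eq hB
    simp [hk]
  · ext
    simp

theorem iIndepFun_eval_of_charFun (hξ : Measurable ξ) {n : ℕ} {B : Fin n → Set S}
    (hB : ∀ i, MeasurableSet (B i))
    (h : ∀ t : Fin n → ℝ, ∫ ω, SimplePointMeasure.countPhase B t (ξ ω) ∂P =
      ∏ i, charFun (P.map fun ω => ((ξ ω).1 (B i)).toReal) (t i)) :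
    iIndepFun (fun i ω => (ξ ω).1 (B i)) P := by
  have heval : ∀ i, Measurable fun ω => ((ξ ω).1 (B i)).toReal := fun i =>
    ((SimplePointMeasure.measurable_eval (hB i)).comp hξ).ennreal_toReal
  have hind : iIndepFun (fun i ω => ((ξ ω).1 (B i)).toReal) P := by
    rw [iIndepFun_iff_charFun_pi fun i => (heval i).aemeasurable]
    intro t
    have hvec : Measurable fun ω => WithLp.toLp 2 fun i => ((ξ ω).1 (B i)).toReal :=
      (WithLp.measurable_toLp 2 _).comp (measurable_pi_lambda _ heval)
    rw [← h fun i => t i, charFun_apply, integral_map hvec.aemeasurable (by fun_prop)]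
    simp [SimplePointMeasure.countPhase, PiLp.inner_apply, mul_comm]
  simpa only [Function.comp_def, ENNReal.ofReal_toReal (measure_ne_top _ _)] using
    hind.comp (fun _ => ENNReal.ofReal) fun _ => ENNReal.measurable_ofReal

theorem isPoissonProcess_of_integral_countPhase {m : Measure S} [IsFiniteMeasure m]
    (hξ : Measurable ξ)
    (h : ∀ (n : ℕ) (B : Fin n → Set S), (∀ i, MeasurableSet (B i)) →
      Pairwise (fun i j => Disjoint (B i) (B j)) → ∀ t : Fin n → ℝ,
      ∫ ω, SimplePointMeasure.countPhase B t (ξ ω) ∂P =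
        ∏ i, Complex.exp (m.real (B i) * (Complex.exp (t i * Complex.I) - 1))) :
    IsPoissonProcess P m ξ := by
  have hchar : ∀ {B : Set S}, MeasurableSet B → ∀ t : ℝ,
      charFun (P.map fun ω => ((ξ ω).1 B).toReal) t =
        Complex.exp (m.real B * (Complex.exp (t * Complex.I) - 1)) := fun {B} hB t => by
    rw [charFun_map_eval_toReal hξ hB,
      h 1 (fun _ => B) (fun _ => hB) Subsingleton.pairwise fun _ => t, Fin.prod_univ_one]
  refine ⟨hξ, fun B hB => measure_eval_eq_of_charFun hξ hB (hchar hB), fun n B hB hd =>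
    iIndepFun_eval_of_charFun hξ hB fun t => ?_⟩
  simp only [h n B hB hd, hchar (hB _)]

theorem isPoissonProcess_of_map_eq_poissonMixture [MeasurableEq S] {U : Measure S}
    [IsProbabilityMeasure U] [NullSingletonClass U] {a : ℝ≥0} (hξ : Measurable ξ)
    (h : P.map ξ = poissonMixture U a) : IsPoissonProcess P (a • U) ξ := by
  refine isPoissonProcess_of_integral_countPhase hξ fun n B hB hd t => ?_
  rw [← integral_countPhase_poissonMixture U a hB hd t, ← h, integral_map hξ.aemeasurable
    (SimplePointMeasure.measurable_countPhase hB t).aestronglyMeasurable]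

theorem IsPoissonProcess.map_eq_poissonMixture [MeasurableEq S] {U : Measure S}
    [IsProbabilityMeasure U] [NullSingletonClass U] {a : ℝ≥0}
    (h : IsPoissonProcess P (a • U) ξ) : P.map ξ = poissonMixture U a :=
  (h.map_eq_map (isPoissonProcess_of_map_eq_poissonMixture (P := poissonMixture U a) measurable_id
    Measure.map_id)).trans Measure.map_id

end OfCharacteristicFunction

end MixedBinomial

section PoissonArithmetic

/-- The probability that a Poisson variable with mean `a` takes the value `n`. -/
noncomputable def poissonProb (a : ℝ≥0) (n : ℕ) : ℝ := (poissonMeasure a).real {n}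

/-- The probability that a Poisson variable with mean `a` is *strictly* smaller than `n`. -/
noncomputable def poissonCdf (a : ℝ≥0) (n : ℕ) : ℝ := ∑ i ∈ Finset.range n, poissonProb a i

theorem poissonProb_eq (a : ℝ≥0) (n : ℕ) :
    poissonProb a n = Real.exp (-a) * a ^ n / (n.factorial : ℝ) :=
  poissonMeasure_real_singleton a n

theorem poissonProb_nonneg (a : ℝ≥0) (n : ℕ) : 0 ≤ poissonProb a n := measureReal_nonneg

theorem poissonProb_pos {a : ℝ≥0} (ha : 0 < a) (n : ℕ) : 0 < poissonProb a n :=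
  poissonMeasure_real_singleton_pos n ha

theorem ofReal_poissonProb (a : ℝ≥0) (n : ℕ) :
    ENNReal.ofReal (poissonProb a n) = poissonMeasure a {n} := by
  rw [poissonProb, Measure.real, ENNReal.ofReal_toReal (measure_ne_top _ _)]

theorem poissonProb_succ (a : ℝ≥0) (n : ℕ) :
    poissonProb a (n + 1) = poissonProb a n * (a / (n + 1)) := by
  rw [poissonProb_eq, poissonProb_eq, Nat.factorial_succ, pow_succ]
  push_cast
  field_simp

theorem hasSum_poissonProb (a : ℝ≥0) : HasSum (poissonProb a) 1 := by
  rw [show poissonProb a = _ from funext (poissonProb_eq a)]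
  exact hasSum_one_poissonMeasure a

theorem poissonCdf_succ (a : ℝ≥0) (n : ℕ) :
    poissonCdf a (n + 1) = poissonCdf a n + poissonProb a n := Finset.sum_range_succ _ _

theorem poissonCdf_nonneg (a : ℝ≥0) (n : ℕ) : 0 ≤ poissonCdf a n :=
  Finset.sum_nonneg fun _ _ => poissonProb_nonneg _ _

theorem poissonCdf_mono (a : ℝ≥0) : Monotone (poissonCdf a) :=
  monotone_nat_of_le_succ fun n => by
    rw [poissonCdf_succ]; linarith [poissonProb_nonneg a n]

theorem tendsto_poissonCdf (a : ℝ≥0) :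
    Filter.Tendsto (poissonCdf a) Filter.atTop (nhds 1) := (hasSum_poissonProb a).tendsto_sum_nat

theorem poissonCdf_le_one (a : ℝ≥0) (n : ℕ) : poissonCdf a n ≤ 1 :=
  (poissonCdf_mono a).ge_of_tendsto (tendsto_poissonCdf a) n

theorem poissonMeasure_real_Iio (a : ℝ≥0) (n : ℕ) :
    (poissonMeasure a).real (Set.Iio n) = poissonCdf a n := by
  rw [poissonCdf]
  simp only [poissonProb]
  rw [sum_measureReal_singleton, Finset.coe_range]

variable {a b : ℝ≥0}

theorem poissonProb_le_of_le (hab : b < a) {m n : ℕ} (hmn : m ≤ n)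
    (h : poissonProb a n ≤ poissonProb b n) : poissonProb a m ≤ poissonProb b m := by
  induction n, hmn using Nat.le_induction with
  | base => exact h
  | succ n _ ih =>
    refine ih ?_
    rw [poissonProb_succ, poissonProb_succ] at h
    have hab' : (b : ℝ) < a := hab
    by_contra! hlt
    have h1 : (b : ℝ) / (n + 1) < a / (n + 1) := by gcongr
    have h2 := mul_lt_mul'' hlt h1 (poissonProb_nonneg b n) (by positivity)
    linarith

theorem exists_poissonProb_lt (hab : b < a) :
    ∃ n, poissonProb b n < poissonProb a n := by
  by_contra! h
  have h0 : poissonProb a 0 < poissonProb b 0 := by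
    simpa [poissonProb_eq] using hab
  exact (hasSum_lt h h0 (hasSum_poissonProb a) (hasSum_poissonProb b)).false

/-- The ratio `P(X = n + 1) / P(Y = n)` for Poisson variables `X` and `Y` with means `a` and `b`. It
governs the sign of the increments of `n ↦ P(Y < n) - P(X < n + 1)`. -/
noncomputable def poissonRatio (a b : ℝ≥0) (n : ℕ) : ℝ := poissonProb a (n + 1) / poissonProb b n

theorem exists_lt_succ_of_lt {α : Type*} [LinearOrder α] {f : ℕ → α} {m n : ℕ} (hmn : m ≤ n)
    (h : f m < f n) : ∃ k, m ≤ k ∧ k < n ∧ f k < f (k + 1) := by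
  induction n, hmn using Nat.le_induction with
  | base => exact absurd h (lt_irrefl _)
  | succ n hmn ih =>
    rcases le_or_gt (f n) (f m) with hle | hlt
    · exact ⟨n, hmn, n.lt_succ_self, hle.trans_lt h⟩
    · obtain ⟨k, hmk, hkn, hk⟩ := ih hlt
      exact ⟨k, hmk, hkn.trans n.lt_succ_self, hk⟩

theorem poissonRatio_le_succ_iff (ha : 0 < a) (hb : 0 < b) (n : ℕ) :
    poissonRatio a b n ≤ poissonRatio a b (n + 1) ↔ (b : ℝ) * (n + 2) ≤ a * (n + 1) := by
  have : (0 : ℝ) < b := hb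
  have hbn := poissonProb_pos hb n
  have hpos : 0 < poissonRatio a b n := div_pos (poissonProb_pos ha _) hbn
  have hsucc : poissonRatio a b (n + 1) = poissonRatio a b n * (a * (n + 1) / (b * (n + 2))) := by
    rw [poissonRatio, poissonRatio, poissonProb_succ a (n + 1), poissonProb_succ b n]
    push_cast
    field_simp
    ring
  rw [hsucc, le_mul_iff_one_le_right hpos, one_le_div (by positivity)]

theorem poissonRatio_le_succ_of_le (hb : 0 < b) (hab : b < a) {l n : ℕ} (hln : l ≤ n)
    (h : poissonRatio a b l ≤ poissonRatio a b (l + 1)) :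
    poissonRatio a b n ≤ poissonRatio a b (n + 1) := by
  rw [poissonRatio_le_succ_iff (hb.trans hab) hb] at h ⊢
  have hln' : (l : ℝ) ≤ n := by exact_mod_cast hln
  nlinarith [NNReal.coe_lt_coe.2 hab]

theorem poissonRatio_le_of_lt (hb : 0 < b) (hab : b < a) {i j l : ℕ} (hij : i ≤ j) (hjl : j ≤ l)
    (h : poissonRatio a b i < poissonRatio a b j) : poissonRatio a b j ≤ poissonRatio a b l := by
  obtain ⟨k, _, hkj, hk⟩ := exists_lt_succ_of_lt hij h
  have hstep : ∀ n, j ≤ n → poissonRatio a b n ≤ poissonRatio a b (n + 1) := fun n hjn =>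
    poissonRatio_le_succ_of_le hb hab (hkj.le.trans hjn) hk.le
  exact Nat.rel_of_forall_rel_succ_of_le_of_le (· ≤ ·) hstep le_rfl hjl

theorem poissonCdf_sub_lt_succ_iff (hb : 0 < b) (n : ℕ) :
    poissonCdf b n - poissonCdf a (n + 1) < poissonCdf b (n + 1) - poissonCdf a (n + 2) ↔
      poissonRatio a b n < 1 := by
  rw [poissonRatio, div_lt_one (poissonProb_pos hb n), poissonCdf_succ a (n + 1),
    poissonCdf_succ b n]
  constructor <;> intro h <;> linarith

theorem poissonCdf_sub_succ_lt_iff (hb : 0 < b) (n : ℕ) :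
    poissonCdf b (n + 1) - poissonCdf a (n + 2) < poissonCdf b n - poissonCdf a (n + 1) ↔
      1 < poissonRatio a b n := by
  rw [poissonRatio, one_lt_div (poissonProb_pos hb n), poissonCdf_succ a (n + 1),
    poissonCdf_succ b n]
  constructor <;> intro h <;> linarith

theorem tendsto_poissonCdf_sub (a b : ℝ≥0) :
    Filter.Tendsto (fun n => poissonCdf b n - poissonCdf a (n + 1)) Filter.atTop (nhds 0) := by
  simpa using (tendsto_poissonCdf b).sub
    ((tendsto_poissonCdf a).comp (Filter.tendsto_add_atTop_nat 1))

/-- The difference `P(Y < n) - P(X < n + 1)` is negative at `n = 0` and tends to `0`. Were it to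
become nonnegative and then negative again, its increments would have changed sign twice by then,
so they would stay negative and the limit could not be `0`. -/
theorem poissonCdf_succ_le_of_le (hb : 0 < b) (hab : b < a) {n m : ℕ} (hnm : n ≤ m)
    (h : poissonCdf a (n + 1) ≤ poissonCdf b n) : poissonCdf a (m + 1) ≤ poissonCdf b m := by
  set D : ℕ → ℝ := fun n => poissonCdf b n - poissonCdf a (n + 1) with hD
  by_contra! hneg
  have hDm : D m < 0 := sub_neg.2 hneg
  have hDn : 0 ≤ D n := sub_nonneg.2 h
  have hD0 : D 0 < 0 := by simpa [hD, poissonCdf] using poissonProb_pos (hb.trans hab) 0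
  obtain ⟨i, -, hin, hi⟩ := exists_lt_succ_of_lt n.zero_le (hD0.trans_le hDn)
  obtain ⟨j, hnj, hjm, hj⟩ := exists_lt_succ_of_lt (f := fun n => -D n) hnm
    (neg_lt_neg (hDm.trans_le hDn))
  rw [poissonCdf_sub_lt_succ_iff hb] at hi
  rw [neg_lt_neg_iff, poissonCdf_sub_succ_lt_iff hb] at hj
  have hdec : ∀ l, j ≤ l → D (l + 1) ≤ D l := fun l hjl =>
    ((poissonCdf_sub_succ_lt_iff hb l).2 (hj.trans_le
      (poissonRatio_le_of_lt hb hab (hin.le.trans hnj) hjl (hi.trans hj)))).le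
  refine hDm.not_ge (le_of_tendsto (tendsto_poissonCdf_sub a b) ?_)
  filter_upwards [Filter.eventually_ge_atTop m] with l hml
  exact Nat.rel_of_forall_rel_succ_of_le_of_le (· ≥ ·) hdec hjm.le hml

theorem exists_poissonProb_le_iff (hb : 0 < b) (hab : b < a) :
    (∃ k, poissonProb a k ≤ poissonProb b k ∧ poissonCdf a (k + 2) ≤ poissonCdf b (k + 1)) ↔
    ¬ ∃ k, poissonProb b (k + 1) < poissonProb a (k + 1) ∧
      poissonCdf b (k + 1) < poissonCdf a (k + 2) := by
  constructor
  · rintro ⟨k, hk, hk'⟩ ⟨j, hj, hj'⟩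
    have hkj : k ≤ j := by
      by_contra! hlt
      exact absurd (poissonProb_le_of_le hab hlt hk) (not_le.2 hj)
    exact absurd (poissonCdf_succ_le_of_le hb hab (Nat.succ_le_succ hkj) hk') (not_le.2 hj')
  · intro h
    classical
    have hex := exists_poissonProb_lt hab
    obtain ⟨k, hk⟩ : ∃ k, Nat.find hex = k + 1 := by
      refine Nat.exists_eq_succ_of_ne_zero fun h0 => ?_
      have := Nat.find_spec hex
      rw [h0] at this
      refine absurd this (not_lt.2 ?_)
      simpa [poissonProb_eq] using hab.le
    refine ⟨k, not_lt.1 (Nat.find_min hex (by omega)), ?_⟩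
    by_contra! hlt
    exact h ⟨k, hk ▸ Nat.find_spec hex, hlt⟩

end PoissonArithmetic

section Necessity

namespace SimplePointMeasure

variable {S : Type*} [MeasurableSpace S]

theorem count_univ_ofFn {n : ℕ} {x : Fin n → S} (hx : Function.Injective x) :
    (ofFn x).count Set.univ = n := by
  simp [count, ofFn_apply hx]

variable [MeasurableSingletonClass S]

theorem exists_finset_points_eq (ν : SimplePointMeasure S) :
    ∃ A : Finset S, ν.points = A ∧ ν.count Set.univ = A.card ∧
      ν.1 = ∑ x ∈ A, Measure.dirac x := by
  classical
  obtain ⟨_, A, rfl⟩ := ν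
  refine ⟨A, ?_, by simp [count], rfl⟩
  ext x
  simp [points, Measure.finsetSum_apply, Set.indicator_apply]

variable {ν ν' : SimplePointMeasure S}

theorem count_univ_le_of_points_subset (h : ν'.points ⊆ ν.points) :
    ν'.count Set.univ ≤ ν.count Set.univ := by
  obtain ⟨A, hA, hcard, -⟩ := ν.exists_finset_points_eq
  obtain ⟨A', hA', hcard', -⟩ := ν'.exists_finset_points_eq
  rw [hA, hA', Finset.coe_subset] at h
  rw [hcard, hcard']
  exact Finset.card_le_card h

theorem eq_of_points_subset (h : ν'.points ⊆ ν.points)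
    (hle : ν.count Set.univ ≤ ν'.count Set.univ) : ν' = ν := by
  obtain ⟨A, hA, hcard, hν⟩ := ν.exists_finset_points_eq
  obtain ⟨A', hA', hcard', hν'⟩ := ν'.exists_finset_points_eq
  rw [hA, hA', Finset.coe_subset] at h
  rw [hcard, hcard'] at hle
  exact Subtype.ext (by rw [hν, hν', Finset.eq_of_subset_of_card_le h hle])

end SimplePointMeasure

variable {S : Type*} [MeasurableSpace S] {U : Measure S} [IsProbabilityMeasure U]
  {Ω : Type*} [MeasurableSpace Ω] {P : Measure Ω} {a b : ℝ≥0} {ξ : Ω → SimplePointMeasure S}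

theorem IsPoissonProcess.measureReal_count_univ_lt (h : IsPoissonProcess P (a • U) ξ) (n : ℕ) :
    P.real {ω | (ξ ω).count Set.univ < n} = poissonCdf a n := by
  have hmap := h.map_count .univ
  have hmass : ((a • U) Set.univ).toNNReal = a := by simp
  rw [hmass] at hmap
  rw [← poissonMeasure_real_Iio, ← hmap,
    map_measureReal_apply (h.measurable_count .univ) measurableSet_Iio]
  rfl

variable [MeasurableEq S] [NullSingletonClass U]

variable (U) in
theorem ae_count_univ_binomialLaw (n : ℕ) : ∀ᵐ ν ∂binomialLaw U n, ν.count Set.univ = n := by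
  rw [binomialLaw, ae_map_iff (SimplePointMeasure.measurable_ofFn n).aemeasurable
    (measurableSet_eq_fun (SimplePointMeasure.measurable_count .univ) measurable_const)]
  filter_upwards [ae_injective_pi U n] with x hx using SimplePointMeasure.count_univ_ofFn hx

theorem poissonMixture_eq_mul_binomialLaw (a : ℝ≥0) {E : Set (SimplePointMeasure S)}
    (hE : MeasurableSet E) {n : ℕ} (hn : ∀ ν ∈ E, ν.count Set.univ = n) :
    poissonMixture U a E = poissonMeasure a {n} * binomialLaw U n E := by
  rw [poissonMixture_apply U a hE, lintegral_countable', tsum_eq_single n, mul_comm]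
  intro m hm
  have hzero : binomialLaw U m E = 0 := measure_mono_null
    (fun ν hν (h : ν.count Set.univ = m) => hm (h.symm.trans (hn ν hν)))
    (ae_count_univ_binomialLaw U m)
  rw [hzero, zero_mul]

variable [IsProbabilityMeasure P]

/-- If `ξ` and `f ξ` both have `n` points then they agree. Hence `ξ ∈ E` implies `f ξ ∈ E` for the
set `E` below, which amounts to `P(X = n) * β ≤ P(Y = n) * β`, where `β` is the probability of `E`
under the law of `n` independent points. -/
theorem IsPoissonProcess.ae_not_count_eq_and_count_eq
    (hξ : IsPoissonProcess P (a • U) ξ) {f : SimplePointMeasure S → SimplePointMeasure S}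
    (hf : Measurable f) (hfξ : IsPoissonProcess P (b • U) fun ω => f (ξ ω))
    (hsub : ∀ᵐ ω ∂P, (f (ξ ω)).points ⊆ (ξ ω).points) {n : ℕ}
    (hn : poissonProb b n < poissonProb a n) :
    ∀ᵐ ω ∂P, ¬((ξ ω).count Set.univ = n ∧ (f (ξ ω)).count Set.univ = n) := by
  let E : Set (SimplePointMeasure S) :=
    {ν | ν.count Set.univ = n ∧ (f ν).count Set.univ = n}
  have hcount := SimplePointMeasure.measurable_count (S := S) .univ
  have hE : MeasurableSet E := (measurableSet_eq_fun hcount measurable_const).inter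
    (measurableSet_eq_fun (hcount.comp hf) measurable_const)
  have hprob : ∀ {c : ℝ≥0} {ζ : Ω → SimplePointMeasure S}, IsPoissonProcess P (c • U) ζ →
      P (ζ ⁻¹' E) = poissonMeasure c {n} * binomialLaw U n E := fun hζ => by
    rw [← Measure.map_apply hζ.measurable hE, hζ.map_eq_poissonMixture,
      poissonMixture_eq_mul_binomialLaw _ hE fun ν hν => hν.1]
  have hle : P (ξ ⁻¹' E) ≤ P ((fun ω => f (ξ ω)) ⁻¹' E) := by
    refine measure_mono_ae ?_
    filter_upwards [hsub] with ω hω hωE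
    have hfix : f (ξ ω) = ξ ω :=
      SimplePointMeasure.eq_of_points_subset hω (hωE.1.trans hωE.2.symm).le
    exact (congrArg (· ∈ E) hfix).mpr hωE
  have hβ : binomialLaw U n E = 0 := by
    rw [hprob hξ, hprob hfξ, ← ofReal_poissonProb, ← ofReal_poissonProb] at hle
    by_contra hβ
    rw [ENNReal.mul_le_mul_iff_left hβ (measure_ne_top _ _),
      ENNReal.ofReal_le_ofReal_iff (poissonProb_nonneg _ _)] at hle
    exact hle.not_gt hn
  refine measure_eq_zero_iff_ae_notMem.1 (?_ : P (ξ ⁻¹' E) = 0)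
  rw [hprob hξ, hβ, mul_zero]

theorem IsPoissonProcess.poissonCdf_succ_le
    (hξ : IsPoissonProcess P (a • U) ξ) {f : SimplePointMeasure S → SimplePointMeasure S}
    (hf : Measurable f) (hfξ : IsPoissonProcess P (b • U) fun ω => f (ξ ω))
    (hsub : ∀ᵐ ω ∂P, (f (ξ ω)).points ⊆ (ξ ω).points) {n : ℕ}
    (hn : poissonProb b n < poissonProb a n) : poissonCdf a (n + 1) ≤ poissonCdf b n := by
  rw [← hξ.measureReal_count_univ_lt, ← hfξ.measureReal_count_univ_lt]
  refine ENNReal.toReal_mono (measure_ne_top _ _) (measure_mono_ae ?_)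
  filter_upwards [hsub, hξ.ae_not_count_eq_and_count_eq hf hfξ hsub hn] with ω hω hne
  intro (hlt : (ξ ω).count Set.univ < n + 1)
  have hle := SimplePointMeasure.count_univ_le_of_points_subset hω
  exact lt_of_not_ge fun hge => hne ⟨by omega, by omega⟩

end Necessity

section Angle

/-- The angle of a point of the circle, measured in full turns, so that it lies in `[0, 1)`. -/
noncomputable def circleTurn (z : Circle) : ℝ := Int.fract (Complex.arg z / (2 * Real.pi))

theorem circleTurn_nonneg (z : Circle) : 0 ≤ circleTurn z := Int.fract_nonneg _

theorem circleTurn_lt_one (z : Circle) : circleTurn z < 1 := Int.fract_lt_one _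

theorem measurable_circleTurn : Measurable circleTurn :=
  have hcoe : Continuous fun z : Circle => (z : ℂ) := continuous_subtype_val
  measurable_fract.comp ((Complex.measurable_arg.comp hcoe.measurable).div_const _)

theorem circleExp_two_pi_mul_circleTurn (z : Circle) :
    Circle.exp (2 * Real.pi * circleTurn z) = z := by
  rw [circleTurn, Int.fract, mul_sub, Circle.exp_sub, Circle.exp_two_pi_mul_int, div_one,
    mul_div_cancel₀ _ (by positivity), Circle.exp_arg]

theorem circleTurn_exp (t : ℝ) : circleTurn (Circle.exp (2 * Real.pi * t)) = Int.fract t := by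
  obtain ⟨m, hm⟩ := Circle.exp_eq_exp.1
    (circleExp_two_pi_mul_circleTurn (Circle.exp (2 * Real.pi * t)))
  have hshift : circleTurn (Circle.exp (2 * Real.pi * t)) = t + m :=
    mul_left_cancel₀ Real.two_pi_pos.ne' (by linarith)
  rw [eq_comm, Int.fract_eq_iff]
  exact ⟨circleTurn_nonneg _, circleTurn_lt_one _, -m, by rw [hshift]; push_cast; ring⟩

theorem circleTurn_eq_zero {z : Circle} : circleTurn z = 0 ↔ z = 1 := by
  constructor
  · intro h
    rw [← circleExp_two_pi_mul_circleTurn z, h, mul_zero, Circle.exp_zero]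
  · rintro rfl
    simpa using circleTurn_exp 0

theorem circleTurn_div (u v : Circle) :
    circleTurn (u / v) =
      circleTurn u - circleTurn v + if circleTurn u < circleTurn v then 1 else 0 := by
  have hdiv : u / v = Circle.exp (2 * Real.pi * (circleTurn u - circleTurn v)) := by
    rw [mul_sub, Circle.exp_sub, circleExp_two_pi_mul_circleTurn,
      circleExp_two_pi_mul_circleTurn]
  have hu := circleTurn_nonneg u
  have hu' := circleTurn_lt_one u
  have hv := circleTurn_nonneg v
  have hv' := circleTurn_lt_one v
  rw [hdiv, circleTurn_exp, Int.fract_eq_iff]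
  split_ifs with hlt
  · exact ⟨by linarith, by linarith, -1, by simp⟩
  · exact ⟨by linarith, by linarith, 0, by simp⟩

/-- The points of the circle reached from `x` by a positive rotation of at most `t` turns. -/
def circleArc (x : Circle) (t : ℝ) : Set Circle :=
  {y | 0 < circleTurn (y / x) ∧ circleTurn (y / x) ≤ t}

theorem preimage_mul_circleArc (θ x : Circle) (t : ℝ) :
    (fun y => θ * y) ⁻¹' circleArc (θ * x) t = circleArc x t := by
  ext y
  simp [circleArc, mul_div_mul_left_eq_div]

theorem notMem_circleArc_self (x : Circle) (t : ℝ) : x ∉ circleArc x t := by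
  simp [circleArc, circleTurn_eq_zero.2]

theorem measurableSet_mem_circleArc {α : Type*} [MeasurableSpace α] {x y : α → Circle} {t : α → ℝ}
    (hx : Measurable x) (hy : Measurable y) (ht : Measurable t) :
    MeasurableSet {a | y a ∈ circleArc (x a) (t a)} :=
  have hturn : Measurable fun a => circleTurn (y a / x a) := measurable_circleTurn.comp (hy.div hx)
  (measurableSet_lt measurable_const hturn).inter (measurableSet_le hturn ht)

theorem measurableSet_circleArc (x : Circle) (t : ℝ) : MeasurableSet (circleArc x t) :=
  measurableSet_mem_circleArc measurable_const measurable_id measurable_const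

instance : Nontrivial Circle := ⟨1, -1, fun h => by
  have hre := congrArg (fun z : Circle => (z : ℂ).re) h
  norm_num at hre⟩

section Haar

variable (U : Measure Circle) [U.IsHaarMeasure]

theorem measurePreserving_div_pow (c : Circle) {n : ℕ} (hn : n ≠ 0) :
    MeasurePreserving (fun z : Circle => c / z ^ n) U U := by
  have hpow : MeasurePreserving (powMonoidHom n : Circle →* Circle) U U := by
    refine MonoidHom.measurePreserving (continuous_pow n) (fun z => ?_) rfl
    refine ⟨Circle.exp (Complex.arg z / n), ?_⟩
    rw [powMonoidHom_apply, ← Circle.exp_nsmul, nsmul_eq_mul, mul_div_cancel₀ _ (by positivity),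
      Circle.exp_arg]
  exact (Measure.measurePreserving_div_left U c).comp hpow

variable [IsProbabilityMeasure U]

theorem measurePreserving_toCircle :
    MeasurePreserving (AddCircle.toCircle : UnitAddCircle → Circle) volume U := by
  have hm : Measurable (AddCircle.toCircle : UnitAddCircle → Circle) :=
    AddCircle.continuous_toCircle.measurable
  let V : Measure Circle := (volume : Measure UnitAddCircle).map AddCircle.toCircle
  have : IsProbabilityMeasure (volume : Measure UnitAddCircle) := ⟨UnitAddCircle.measure_univ⟩
  have : IsProbabilityMeasure V := Measure.isProbabilityMeasure_map hm.aemeasurable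
  have : V.IsMulLeftInvariant := by
    refine ⟨fun g => ?_⟩
    obtain ⟨s, rfl⟩ := (AddCircle.homeomorphCircle (T := 1) one_ne_zero).surjective g
    rw [AddCircle.homeomorphCircle_apply]
    calc V.map (AddCircle.toCircle s * ·)
        = ((volume : Measure UnitAddCircle).map (s + ·)).map AddCircle.toCircle := by
          rw [Measure.map_map (measurable_const_mul _) hm, Measure.map_map hm
            (measurable_const_add _)]
          simp only [Function.comp_def, AddCircle.toCircle_add]
      _ = V := by rw [(measurePreserving_add_left volume s).map_eq]
  have : V.IsHaarMeasure := Measure.isHaarMeasure_of_isCompact_nonempty_interior V Set.univ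
    isCompact_univ (by simp) (by simp) (by simp)
  exact ⟨hm, Measure.isHaarMeasure_eq_of_isProbabilityMeasure V U⟩

theorem measurePreserving_circleTurn :
    MeasurePreserving circleTurn U (volume.restrict (Set.Ico 0 1)) := by
  refine ⟨measurable_circleTurn, ?_⟩
  have hmk := (measurePreserving_toCircle U).comp (AddCircle.measurePreserving_mk 1 0)
  rw [zero_add, ← restrict_Ico_eq_restrict_Ioc] at hmk
  have hturn : circleTurn ∘ AddCircle.toCircle ∘ ((↑) : ℝ → UnitAddCircle) = Int.fract := by
    ext t
    simp [AddCircle.toCircle_apply_mk, circleTurn_exp]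
  rw [← hmk.map_eq, Measure.map_map measurable_circleTurn hmk.measurable, hturn]
  conv_rhs => rw [← Measure.map_id (μ := volume.restrict (Set.Ico (0 : ℝ) 1))]
  refine Measure.map_congr ?_
  filter_upwards [ae_restrict_mem measurableSet_Ico] with t ht
  exact Int.fract_eq_self.2 ht

end Haar

end Angle

section Thinning

namespace SimplePointMeasure

section Kernel

variable {S : Type*} [MeasurableSpace S]

variable (S) in
/-- The tautological kernel `ν ↦ ν`. Being s-finite, it makes integrals with respect to a simple
point measure depend measurably on that measure. -/
noncomputable def kernel : Kernel (SimplePointMeasure S) S :=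
  ⟨fun ν => ν.1, measurable_subtype_coe⟩

theorem kernel_apply (ν : SimplePointMeasure S) : kernel S ν = ν.1 := rfl

instance : IsSFiniteKernel (kernel S) := by
  classical
  have hs : ∀ n, MeasurableSet {ν : SimplePointMeasure S | ν.count Set.univ = n} := fun n =>
    measurableSet_eq_fun (measurable_count .univ) measurable_const
  let κ : ℕ → Kernel (SimplePointMeasure S) S := fun n => Kernel.piecewise (hs n) (kernel S) 0
  have hfin : ∀ n, IsFiniteKernel (κ n) := fun n => by
    refine ⟨⟨n, ENNReal.natCast_lt_top n, fun ν => ?_⟩⟩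
    rw [Kernel.piecewise_apply]
    split_ifs with h
    · rw [kernel_apply, ← ν.natCast_count .univ]
      exact_mod_cast h.le
    · simp
  have hsum : kernel S = Kernel.sum κ := by
    ext ν B hB
    rw [Kernel.sum_apply' _ _ hB, tsum_eq_single (ν.count Set.univ)]
    · simp [κ, Kernel.piecewise_apply]
    · intro n hn
      simp [κ, Kernel.piecewise_apply, hn.symm]
  rw [hsum]
  infer_instance

variable {α : Type*} [MeasurableSpace α] {ν : α → SimplePointMeasure S}

theorem measurable_lintegral_of_prod (hν : Measurable ν) {f : α → S → ℝ≥0∞}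
    (hf : Measurable (Function.uncurry f)) : Measurable fun a => ∫⁻ y, f a y ∂(ν a).1 :=
  hf.lintegral_kernel_prod_right (κ := (kernel S).comap ν hν)

theorem measurable_eval_of_prod (hν : Measurable ν) {B : α → Set S}
    (hB : MeasurableSet {p : α × S | p.2 ∈ B p.1}) : Measurable fun a => (ν a).1 (B a) :=
  Kernel.measurable_kernel_prodMk_left (κ := (kernel S).comap ν hν) hB

theorem measurable_count_of_prod (hν : Measurable ν) {B : α → Set S}
    (hB : MeasurableSet {p : α × S | p.2 ∈ B p.1}) : Measurable fun a => (ν a).count (B a) :=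
  Nat.measurable_floor.comp (measurable_eval_of_prod hν hB).ennreal_toReal

end Kernel

/-- A point `x` is removable in `ν` if, for each `1 ≤ j < n`, there are at least `j` points of `ν`
within `j / n` turns after `x`, where `n` is the number of points of `ν`. -/
def IsRemovable (ν : SimplePointMeasure Circle) (x : Circle) : Prop :=
  ∀ j, 1 ≤ j → j < ν.count Set.univ → j ≤ ν.count (circleArc x (j / ν.count Set.univ))

theorem measurableSet_isRemovable_prod :
    MeasurableSet {p : SimplePointMeasure Circle × Circle | IsRemovable p.1 p.2} := by
  have hN : Measurable fun p : SimplePointMeasure Circle × Circle => p.1.count Set.univ :=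
    (measurable_count .univ).comp measurable_fst
  have harc (j : ℕ) : Measurable fun p : SimplePointMeasure Circle × Circle =>
      p.1.count (circleArc p.2 (j / p.1.count Set.univ)) := by
    refine measurable_count_of_prod measurable_fst
      (measurableSet_mem_circleArc (measurable_snd.comp measurable_fst) measurable_snd ?_)
    exact (Measurable.of_discrete (f := fun n : ℕ => (j / n : ℝ))).comp (hN.comp measurable_fst)
  exact measurableSet_setOfPred.2 (.forall fun j => measurable_const.imp
    ((measurableSet_lt measurable_const hN).mem.imp
      (measurableSet_le measurable_const (harc j)).mem))

theorem measurableSet_isRemovable (ν : SimplePointMeasure Circle) :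
    MeasurableSet {x | IsRemovable ν x} :=
  measurable_prodMk_left measurableSet_isRemovable_prod

theorem _root_.IsSimplePointMeasure.restrict {S : Type*} [MeasurableSpace S] {ν : Measure S}
    (hν : IsSimplePointMeasure ν) {s : Set S} (hs : MeasurableSet s) :
    IsSimplePointMeasure (ν.restrict s) := by
  classical
  obtain ⟨A, rfl⟩ := hν
  refine ⟨A.filter (· ∈ s), ?_⟩
  ext B hB
  simp only [Measure.restrict_apply hB, Measure.finsetSum_apply, Finset.sum_filter,
    Measure.dirac_apply' _ (hB.inter hs)]
  refine Finset.sum_congr rfl fun x _ => ?_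
  by_cases hx : x ∈ s <;> simp [Measure.dirac_apply' _ hB, Set.indicator_apply, hx]

/-- The configuration obtained from `ν` by deleting its removable points. Almost surely there is
exactly one of them. -/
noncomputable def thin (ν : SimplePointMeasure Circle) : SimplePointMeasure Circle :=
  ⟨ν.1.restrict {x | IsRemovable ν x}ᶜ, ν.2.restrict (measurableSet_isRemovable ν).compl⟩

theorem thin_apply (ν : SimplePointMeasure Circle) {B : Set Circle} (hB : MeasurableSet B) :
    (thin ν).1 B = ν.1 (B ∩ {x | IsRemovable ν x}ᶜ) :=
  Measure.restrict_apply hB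

theorem measurable_thin : Measurable thin := by
  refine measurable_of_eval fun B hB => ?_
  simp only [thin_apply _ hB]
  exact measurable_eval_of_prod measurable_id
    ((measurable_snd hB).inter measurableSet_isRemovable_prod.compl)

theorem points_thin_subset (ν : SimplePointMeasure Circle) : (thin ν).points ⊆ ν.points := by
  intro x (hx : (thin ν).1 {x} = 1)
  rw [thin_apply ν (measurableSet_singleton x)] at hx
  by_cases h : IsRemovable ν x
  · rw [Set.singleton_inter_eq_empty.2 (not_not_intro h)] at hx
    simp at hx
  · rwa [Set.inter_eq_left.2 (Set.singleton_subset_iff.2 h)] at hx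

theorem points_iterate_thin_subset (j : ℕ) (ν : SimplePointMeasure Circle) :
    (thin^[j] ν).points ⊆ ν.points := by
  induction j with
  | zero => exact subset_rfl
  | succ j ih =>
    rw [Function.iterate_succ_apply']
    exact (points_thin_subset _).trans ih

/-- The sum of the angles from the removable points of `ν` to all points of `ν`. -/
noncomputable def turnSum (ν : SimplePointMeasure Circle) : ℝ :=
  (∫⁻ x, {x | IsRemovable ν x}.indicator
    (fun x => ∫⁻ y, ENNReal.ofReal (circleTurn (y / x)) ∂ν.1) x ∂ν.1).toReal

/-- A rotation-invariant mark in the circle. Conditionally on the number of points and on the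
remaining points after `thin`, it is uniform: it is the source of randomness that decides how many
points are deleted. -/
noncomputable def mark (ν : SimplePointMeasure Circle) : Circle :=
  Circle.exp (2 * Real.pi * (ν.count Set.univ * turnSum ν))

theorem measurable_turnSum : Measurable turnSum := by
  have hturn : Measurable fun p : SimplePointMeasure Circle × Circle =>
      ∫⁻ y, ENNReal.ofReal (circleTurn (y / p.2)) ∂p.1.1 :=
    measurable_lintegral_of_prod measurable_fst (measurable_circleTurn.comp
      (measurable_snd.div (measurable_snd.comp measurable_fst))).ennreal_ofReal
  exact (measurable_lintegral_of_prod measurable_id (f := fun ν => {x | IsRemovable ν x}.indicator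
    fun x => ∫⁻ y, ENNReal.ofReal (circleTurn (y / x)) ∂ν.1)
    (hturn.indicator measurableSet_isRemovable_prod)).ennreal_toReal

theorem measurable_mark : Measurable mark := by
  have hN : Measurable fun ν : SimplePointMeasure Circle => (ν.count Set.univ : ℝ) :=
    (Measurable.of_discrete (f := (Nat.cast : ℕ → ℝ))).comp (measurable_count .univ)
  exact Circle.exp.continuous.measurable.comp ((hN.mul measurable_turnSum).const_mul _)

section Rotation

variable (θ : Circle) (ν : SimplePointMeasure Circle)

theorem rotate_apply {B : Set Circle} (hB : MeasurableSet B) :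
    (ν.rotate θ).1 B = ν.1 ((fun x => θ * x) ⁻¹' B) :=
  Measure.map_apply (measurable_const_mul θ) hB

theorem count_rotate {B : Set Circle} (hB : MeasurableSet B) :
    (ν.rotate θ).count B = ν.count ((fun x => θ * x) ⁻¹' B) := by
  rw [count, rotate_apply θ ν hB, count]

theorem count_univ_rotate : (ν.rotate θ).count Set.univ = ν.count Set.univ :=
  count_rotate θ ν .univ

theorem lintegral_rotate (f : Circle → ℝ≥0∞) :
    ∫⁻ x, f x ∂(ν.rotate θ).1 = ∫⁻ x, f (θ * x) ∂ν.1 :=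
  lintegral_map_equiv f (MeasurableEquiv.mulLeft θ)

theorem isRemovable_rotate {x : Circle} :
    IsRemovable (ν.rotate θ) (θ * x) ↔ IsRemovable ν x := by
  simp only [IsRemovable, count_univ_rotate, count_rotate _ _ (measurableSet_circleArc _ _),
    preimage_mul_circleArc]

theorem rotate_thin : (thin ν).rotate θ = thin (ν.rotate θ) := by
  refine Subtype.ext (Measure.ext fun B hB => ?_)
  rw [rotate_apply _ _ hB, thin_apply _ (measurable_const_mul θ hB), thin_apply _ hB,
    rotate_apply _ _ (hB.inter (measurableSet_isRemovable _).compl)]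
  congr 1
  ext x
  simp [isRemovable_rotate]

theorem rotate_iterate_thin (j : ℕ) : (thin^[j] ν).rotate θ = thin^[j] (ν.rotate θ) :=
  (show Function.Semiconj (rotate θ) thin thin from rotate_thin θ).iterate_right j ν

theorem turnSum_rotate : turnSum (ν.rotate θ) = turnSum ν := by
  classical
  simp only [turnSum, lintegral_rotate, Set.indicator_apply, Set.mem_ofPred_eq, isRemovable_rotate,
    mul_div_mul_left_eq_div]

theorem mark_rotate : mark (ν.rotate θ) = mark ν := by
  rw [mark, mark, turnSum_rotate, count_univ_rotate]

end Rotation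

end SimplePointMeasure

end Thinning

section RemovablePoint

namespace SimplePointMeasure

open Classical in
theorem count_ofFn {S : Type*} [MeasurableSpace S] {n : ℕ} {x : Fin n → S}
    (hx : Function.Injective x) {B : Set S} (hB : MeasurableSet B) :
    (ofFn x).count B = (Finset.univ.filter fun l => x l ∈ B).card := by
  rw [count_eq_iff _ hB, ofFn_apply hx]
  simp [Measure.finsetSum_apply, Measure.dirac_apply' _ hB, Set.indicator_apply]

theorem lintegral_ofFn {S : Type*} [MeasurableSpace S] [MeasurableSingletonClass S] {n : ℕ}
    {x : Fin n → S} (hx : Function.Injective x) (f : S → ℝ≥0∞) :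
    ∫⁻ y, f y ∂(ofFn x).1 = ∑ l, f (x l) := by
  rw [ofFn_apply hx, lintegral_finsetSum_measure]
  simp

end SimplePointMeasure

theorem sum_circleTurn_div {ι : Type*} [Fintype ι] (x : ι → Circle) (u v : Circle) :
    ∑ l, circleTurn (x l / v) = ∑ l, circleTurn (x l / u) - Fintype.card ι * circleTurn (v / u) +
      (Finset.univ.filter fun l => circleTurn (x l / u) < circleTurn (v / u)).card := by
  have hdiv : ∀ l, circleTurn (x l / v) = circleTurn (x l / u) - circleTurn (v / u) +
      if circleTurn (x l / u) < circleTurn (v / u) then 1 else 0 := fun l => by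
    rw [← circleTurn_div, div_div_div_cancel_right]
  simp [hdiv, Finset.sum_add_distrib, Finset.sum_sub_distrib]

theorem lt_card_filter_le_div_card {ι : Type*} [Fintype ι] {d : ι → ℝ}
    (hd : ∀ m, Fintype.card ι * d m ≤ (Finset.univ.filter fun l => d l < d m).card) {j : ℕ}
    (hj : j < Fintype.card ι) :
    j < (Finset.univ.filter fun l => d l ≤ j / Fintype.card ι).card := by
  classical
  by_contra! hle
  have hcard : (0 : ℝ) < Fintype.card ι := by exact_mod_cast j.zero_le.trans_lt hj
  have hne : (Finset.univ.filter fun l => d l ≤ j / Fintype.card ι)ᶜ.Nonempty := by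
    rw [← Finset.card_pos, Finset.card_compl]
    omega
  obtain ⟨m, hm, hmin⟩ := Finset.exists_min_image _ d hne
  simp only [Finset.mem_compl, Finset.mem_filter_univ, not_le, div_lt_iff₀' hcard] at hm
  have hsub : (Finset.univ.filter fun l => d l < d m) ⊆
      Finset.univ.filter fun l => d l ≤ j / Fintype.card ι := fun l hl => by
    by_contra hl'
    exact (hmin l (Finset.mem_compl.2 hl')).not_gt (Finset.mem_filter.1 hl).2
  have hcount : ((Finset.univ.filter fun l => d l < d m).card : ℝ) ≤ j := by
    exact_mod_cast (Finset.card_le_card hsub).trans hle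
  exact absurd (hd m) (hcount.trans_lt hm).not_ge

namespace SimplePointMeasure

open Classical in
/-- The positions `z` at which an additional point would be removable in the configuration formed
by `A 0, …, A (k - 1)` and `z`. -/
def removableSet {k : ℕ} (A : Fin k → Circle) : Set Circle :=
  {z | ∀ j, 1 ≤ j → j < k + 1 →
    j ≤ (Finset.univ.filter fun l => A l ∈ circleArc z (j / (k + 1 : ℕ))).card}

variable {k : ℕ} {x : Fin (k + 1) → Circle}

theorem isRemovable_ofFn (hx : Function.Injective x) (i : Fin (k + 1)) :
    IsRemovable (ofFn x) (x i) ↔ x i ∈ removableSet (i.removeNth x) := by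
  classical
  have hcount : ∀ t, (ofFn x).count (circleArc (x i) t) =
      (Finset.univ.filter fun l => i.removeNth x l ∈ circleArc (x i) t).card := fun t => by
    rw [count_ofFn hx (measurableSet_circleArc _ _), Finset.card_filter, Finset.card_filter,
      Fin.sum_univ_succAbove _ i, if_neg (notMem_circleArc_self _ _), zero_add]
    exact Finset.sum_congr rfl fun l _ => by congr
  simp only [IsRemovable, count_univ_ofFn hx, hcount]
  rfl

/-- A cycle lemma: the point from which the sum of the angles to all points is least is
removable. -/
theorem exists_isRemovable_ofFn (hx : Function.Injective x) :
    ∃ i, IsRemovable (ofFn x) (x i) := by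
  classical
  obtain ⟨i, hi⟩ := Finite.exists_min fun i => ∑ l, circleTurn (x l / x i)
  have hd : ∀ m, Fintype.card (Fin (k + 1)) * circleTurn (x m / x i) ≤
      (Finset.univ.filter fun l => circleTurn (x l / x i) < circleTurn (x m / x i)).card :=
    fun m => by linarith [hi m, sum_circleTurn_div x (x i) (x m)]
  refine ⟨i, fun j _ hj => ?_⟩
  rw [count_univ_ofFn hx] at hj ⊢
  have hlt := lt_card_filter_le_div_card hd (j := j) (by rwa [Fintype.card_fin])
  rw [Fintype.card_fin] at hlt
  rw [count_ofFn hx (measurableSet_circleArc _ _), ← Nat.lt_succ_iff]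
  refine hlt.trans_le ((Finset.card_le_card fun l hl => ?_).trans (Finset.card_insert_le i _))
  rcases eq_or_ne l i with rfl | hli
  · exact Finset.mem_insert_self _ _
  · refine Finset.mem_insert_of_mem (Finset.mem_filter.2 ⟨Finset.mem_univ _, ?_,
      (Finset.mem_filter.1 hl).2⟩)
    exact (circleTurn_nonneg _).lt_of_ne' fun h0 =>
      hli (hx (div_eq_one.1 (circleTurn_eq_zero.1 h0)))

end SimplePointMeasure

/-- The rotation of the circle by `i / n` turns. -/
noncomputable def circleRoot (n i : ℕ) : Circle := Circle.exp (2 * Real.pi * (i / n))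

theorem circleRoot_pow {n : ℕ} (hn : n ≠ 0) (i : ℕ) : circleRoot n i ^ n = 1 := by
  have hturns : (n : ℝ) * (2 * Real.pi * (i / n)) = 2 * Real.pi * (i : ℤ) := by
    push_cast
    field_simp
  rw [circleRoot, ← Circle.exp_nsmul, nsmul_eq_mul, hturns, Circle.exp_two_pi_mul_int]

theorem circleTurn_circleRoot {n i : ℕ} (hi : i < n) : circleTurn (circleRoot n i) = i / n := by
  have hn : (0 : ℝ) < n := by exact_mod_cast i.zero_le.trans_lt hi
  rw [circleRoot, circleTurn_exp, Int.fract_eq_self]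
  exact ⟨by positivity, (div_lt_one hn).2 (by exact_mod_cast hi)⟩

theorem circleRoot_add (n i j : ℕ) : circleRoot n (i + j) = circleRoot n i * circleRoot n j := by
  rw [circleRoot, circleRoot, circleRoot, ← Circle.exp_add]
  push_cast
  ring_nf

theorem disjoint_circleArc_mul (z w : Circle) :
    Disjoint (circleArc z (circleTurn w)) (circleArc (w * z) (1 - circleTurn w)) := by
  rw [Set.disjoint_left]
  rintro y ⟨hpos, hle⟩ ⟨hpos', hle'⟩
  rw [mul_comm, div_mul_eq_div_div, circleTurn_div] at hpos' hle'
  split_ifs at hpos' hle' <;> linarith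

theorem circleExp_sum {ι : Type*} (s : Finset ι) (f : ι → ℝ) :
    Circle.exp (∑ i ∈ s, f i) = ∏ i ∈ s, Circle.exp (f i) :=
  map_sum Circle.expHom f s

namespace SimplePointMeasure

variable {k : ℕ}

theorem circleRoot_mul_notMem_removableSet {A : Fin k → Circle} {z : Circle}
    (hz : z ∈ removableSet A) {i : ℕ} (hi : 1 ≤ i) (hik : i < k + 1) :
    circleRoot (k + 1) i * z ∉ removableSet A := by
  classical
  intro hz'
  have hcard := hz i hi hik
  have hcard' := hz' (k + 1 - i) (by omega) (by omega)
  have hcompl : ((k + 1 - i : ℕ) / (k + 1 : ℕ) : ℝ) = 1 - i / (k + 1 : ℕ) := by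
    rw [Nat.cast_sub hik.le, sub_div, div_self (by positivity)]
  rw [hcompl, ← circleTurn_circleRoot hik] at hcard'
  rw [← circleTurn_circleRoot hik] at hcard
  have harcs := Set.disjoint_left.1 (disjoint_circleArc_mul z (circleRoot (k + 1) i))
  have hle := Finset.card_le_univ <| Finset.disjUnion _ _ <|
    Finset.disjoint_filter (s := Finset.univ) |>.2 fun l _ => harcs (a := A l)
  rw [Finset.card_disjUnion, Fintype.card_fin] at hle
  omega

variable {x : Fin (k + 1) → Circle} {i : Fin (k + 1)}

theorem thin_ofFn (hx : Function.Injective x) (hi : ∀ l, IsRemovable (ofFn x) (x l) ↔ l = i) :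
    thin (ofFn x) = ofFn (i.removeNth x) := by
  classical
  refine Subtype.ext (Measure.ext fun B hB => ?_)
  have hx' : Function.Injective (i.removeNth x) := hx.comp Fin.succAbove_right_injective
  have hBi := hB.inter (measurableSet_isRemovable (ofFn x)).compl
  rw [thin_apply _ hB, ofFn_apply hx, ofFn_apply hx', Measure.finsetSum_apply,
    Measure.finsetSum_apply, Fin.sum_univ_succAbove _ i]
  simp only [Measure.dirac_apply' _ hBi, Measure.dirac_apply' _ hB]
  simp [Set.indicator_apply, hi, Fin.removeNth]

theorem mark_ofFn (hx : Function.Injective x) (hi : ∀ l, IsRemovable (ofFn x) (x l) ↔ l = i) :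
    mark (ofFn x) = (∏ l, i.removeNth x l / x i) ^ (k + 1) := by
  have hsum : turnSum (ofFn x) = ∑ l, circleTurn (x l / x i) := by
    classical
    simp only [turnSum, lintegral_ofFn hx, Set.indicator_apply, Set.mem_ofPred_eq, hi,
      Finset.sum_ite_eq', Finset.mem_univ, if_true]
    rw [← ENNReal.ofReal_sum_of_nonneg fun l _ => circleTurn_nonneg _,
      ENNReal.toReal_ofReal (Finset.sum_nonneg fun l _ => circleTurn_nonneg _)]
  rw [mark, hsum, count_univ_ofFn hx, mul_left_comm, ← nsmul_eq_mul, Circle.exp_nsmul,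
    Finset.mul_sum, circleExp_sum]
  simp [circleExp_two_pi_mul_circleTurn, Fin.prod_univ_succAbove _ i, Fin.removeNth]

end SimplePointMeasure

end RemovablePoint

section Averaging

variable {G : Type*} [Group G] [MeasurableSpace G] [MeasurableMul G] (U : Measure G)
  [U.IsMulLeftInvariant]

theorem lintegral_sum_mul_left {ι : Type*} [Fintype ι] (g : ι → G) {f : G → ℝ≥0∞}
    (hf : Measurable f) :
    ∫⁻ z, ∑ i, f (g i * z) ∂U = Fintype.card ι * ∫⁻ z, f z ∂U := by
  have hmeas : ∀ i, Measurable fun z => f (g i * z) := fun i => hf.comp (measurable_const_mul (g i))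
  rw [lintegral_finsetSum _ fun i _ => hmeas i]
  simp [lintegral_mul_left_eq_self]

theorem lintegral_sum_removeNth [SigmaFinite U] {k : ℕ} (g : Fin (k + 1) → G)
    {f : G → (Fin k → G) → ℝ≥0∞} (hf : Measurable (Function.uncurry f)) :
    ∫⁻ x, ∑ i : Fin (k + 1), f (x i) (i.removeNth x) ∂Measure.pi (fun _ => U) =
      ∫⁻ A, ∫⁻ z, ∑ i, f (g i * z) A ∂U ∂Measure.pi (fun _ => U) := by
  have hterm : ∀ i : Fin (k + 1), ∫⁻ x, f (x i) (i.removeNth x) ∂Measure.pi (fun _ => U) =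
      ∫⁻ A, ∫⁻ z, f z A ∂U ∂Measure.pi (fun _ => U) := fun i =>
    ((measurePreserving_piFinSuccAbove (fun _ => U) i).lintegral_comp hf).trans
      (lintegral_prod_symm' _ hf)
  have hmeas : ∀ i : Fin (k + 1), Measurable fun x : Fin (k + 1) → G => f (x i) (i.removeNth x) :=
    fun i => hf.comp (MeasurableEquiv.piFinSuccAbove (fun _ => G) i).measurable
  have hslice : ∀ A, Measurable fun z => f z A := fun A => hf.comp measurable_prodMk_right
  have hinner : Measurable fun A => ∫⁻ z, f z A ∂U := hf.lintegral_prod_left'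
  rw [lintegral_finsetSum _ fun i _ => hmeas i]
  simp only [hterm, lintegral_sum_mul_left U g (hslice _)]
  rw [lintegral_const_mul _ hinner]
  simp

end Averaging

namespace SimplePointMeasure

section Removal

variable {k : ℕ}

theorem measurableSet_removableSet_prod :
    MeasurableSet {p : Circle × (Fin k → Circle) | p.1 ∈ removableSet p.2} := by
  classical
  have hcard : ∀ t : ℝ, Measurable fun p : Circle × (Fin k → Circle) =>
      (Finset.univ.filter fun l => p.2 l ∈ circleArc p.1 t).card := fun t => by
    simp only [Finset.card_filter]
    exact Finset.measurable_fun_sum _ fun l _ => Measurable.ite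
      (measurableSet_mem_circleArc measurable_fst ((measurable_pi_apply l).comp measurable_snd)
        measurable_const) measurable_const measurable_const
  exact measurableSet_setOfPred.2 (.forall fun j => measurable_const.imp
    (measurable_const.imp (measurableSet_le measurable_const (hcard _)).mem))

open Classical in
/-- The contribution of the point `z` to a function `f` of `thin` and `mark`: the value of `f` for
the configuration formed by `z` and the entries of `A` if `z` is removable in it, and zero
otherwise. -/
noncomputable def removalTerm (f : SimplePointMeasure Circle × Circle → ℝ≥0∞) (z : Circle)
    (A : Fin k → Circle) : ℝ≥0∞ :=
  if z ∈ removableSet A then f (ofFn A, (∏ l, A l / z) ^ (k + 1)) else 0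

theorem measurable_removalTerm {α : Type*} [MeasurableSpace α] {z : α → Circle}
    {A : α → Fin k → Circle} (hz : Measurable z) (hA : Measurable A)
    {f : SimplePointMeasure Circle × Circle → ℝ≥0∞} (hf : Measurable f) :
    Measurable fun a => removalTerm f (z a) (A a) := by
  have hprod : Measurable fun a => ∏ l, A a l / z a :=
    Finset.measurable_fun_prod _ fun l _ => ((measurable_pi_apply l).comp hA).div hz
  have hval : Measurable fun a => f (ofFn (A a), (∏ l, A a l / z a) ^ (k + 1)) :=
    hf.comp (((measurable_ofFn k).comp hA).prodMk (hprod.pow_const _))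
  unfold removalTerm
  exact hval.ite (hz.prodMk hA measurableSet_removableSet_prod) measurable_const

theorem sum_removalTerm_one_circleRoot_mul_le (A : Fin k → Circle) (z : Circle) :
    ∑ i : Fin (k + 1), removalTerm 1 (circleRoot (k + 1) i * z) A ≤ 1 := by
  classical
  have hlt : ∀ i j : Fin (k + 1), i < j → circleRoot (k + 1) i * z ∈ removableSet A →
      circleRoot (k + 1) j * z ∉ removableSet A := fun i j hij hi => by
    have hroot : circleRoot (k + 1) j * z =
        circleRoot (k + 1) (j - i : ℕ) * (circleRoot (k + 1) i * z) := by
      rw [← mul_assoc, ← circleRoot_add, Nat.sub_add_cancel hij.le]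
    rw [hroot]
    exact circleRoot_mul_notMem_removableSet hi (by omega) (by omega)
  simp only [removalTerm, Pi.one_apply, Finset.sum_boole]
  refine Nat.cast_le_one.2 (Finset.card_le_one.2 fun i hi j hj => ?_)
  simp only [Finset.mem_filter_univ] at hi hj
  exact le_antisymm (not_lt.1 fun h => hlt j i h hj hi) (not_lt.1 fun h => hlt i j h hi hj)

theorem sum_removalTerm_circleRoot_mul {A : Fin k → Circle} {z : Circle}
    (hsum : ∑ i : Fin (k + 1), removalTerm 1 (circleRoot (k + 1) i * z) A = 1)
    (f : SimplePointMeasure Circle × Circle → ℝ≥0∞) :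
    ∑ i : Fin (k + 1), removalTerm f (circleRoot (k + 1) i * z) A =
      f (ofFn A, (∏ l, A l / z) ^ (k + 1)) := by
  have hroot : ∀ i : Fin (k + 1), (∏ l, A l / (circleRoot (k + 1) i * z)) ^ (k + 1) =
      (∏ l, A l / z) ^ (k + 1) := fun i => by
    simp only [← Finset.prod_pow, div_pow, mul_pow, circleRoot_pow k.succ_ne_zero, one_mul]
  rw [← one_mul (f _), ← hsum, Finset.sum_mul]
  simp only [removalTerm, hroot, Pi.one_apply, ite_mul, one_mul, zero_mul]

theorem one_le_sum_removalTerm_one_removeNth {x : Fin (k + 1) → Circle}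
    (hx : Function.Injective x) :
    1 ≤ ∑ i : Fin (k + 1), removalTerm 1 (x i) (i.removeNth x) := by
  obtain ⟨i, hi⟩ := exists_isRemovable_ofFn hx
  rw [isRemovable_ofFn hx] at hi
  refine le_trans ?_ (Finset.single_le_sum (fun _ _ => zero_le) (Finset.mem_univ i))
  simp [removalTerm, hi]

theorem apply_thin_mark_ofFn {x : Fin (k + 1) → Circle} (hx : Function.Injective x)
    (hsum : ∑ i : Fin (k + 1), removalTerm 1 (x i) (i.removeNth x) = 1)
    (f : SimplePointMeasure Circle × Circle → ℝ≥0∞) :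
    f (thin (ofFn x), mark (ofFn x)) =
      ∑ i : Fin (k + 1), removalTerm f (x i) (i.removeNth x) := by
  classical
  have hunique : ∃ i, ∀ l, IsRemovable (ofFn x) (x l) ↔ l = i := by
    simpa only [removalTerm, ← isRemovable_ofFn hx, Pi.one_apply, Finset.sum_boole,
      Nat.cast_eq_one, Finset.card_eq_one, Finset.ext_iff, Finset.mem_filter_univ,
      Finset.mem_singleton] using hsum
  obtain ⟨i, hi⟩ := hunique
  simp only [removalTerm, ← isRemovable_ofFn hx, hi, Finset.sum_ite_eq', Finset.mem_univ, if_true,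
    thin_ofFn hx hi, mark_ofFn hx hi]

variable (U : Measure Circle) [U.IsHaarMeasure] [IsProbabilityMeasure U]

/-- By rotation averaging this integral equals that of the sum over `circleRoot`. As one sum is at
least one and the other at most one, both are almost surely equal to one. -/
theorem lintegral_sum_removalTerm_one :
    ∫⁻ x, ∑ i : Fin (k + 1), removalTerm 1 (x i) (i.removeNth x) ∂Measure.pi (fun _ => U) = 1 := by
  refine le_antisymm ?_ ?_
  · rw [lintegral_sum_removeNth U (fun i => circleRoot (k + 1) i)
      (measurable_removalTerm measurable_fst measurable_snd measurable_one)]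
    refine (lintegral_mono fun A => lintegral_mono
      (sum_removalTerm_one_circleRoot_mul_le A)).trans_eq ?_
    simp
  · rw [← lintegral_one.trans (measure_univ (μ := Measure.pi fun _ : Fin (k + 1) => U))]
    exact lintegral_mono_ae ((ae_injective_pi U (k + 1)).mono fun x =>
      one_le_sum_removalTerm_one_removeNth)

theorem ae_sum_removalTerm_one_removeNth :
    ∀ᵐ x ∂Measure.pi (fun _ => U),
      ∑ i : Fin (k + 1), removalTerm 1 (x i) (i.removeNth x) = 1 := by
  have hmeas : Measurable fun x : Fin (k + 1) → Circle =>
      ∑ i, removalTerm 1 (x i) (i.removeNth x) := Finset.measurable_fun_sum _ fun i _ =>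
    measurable_removalTerm (measurable_pi_apply i)
      (measurable_pi_lambda _ fun l => measurable_pi_apply (i.succAbove l)) measurable_one
  have heq := ae_eq_of_ae_le_of_lintegral_le (f := fun _ => 1)
    ((ae_injective_pi U (k + 1)).mono fun x => one_le_sum_removalTerm_one_removeNth) (by simp)
    hmeas.aemeasurable (by simp [lintegral_sum_removalTerm_one U])
  exact heq.mono fun x hx => hx.symm

theorem ae_sum_removalTerm_one_circleRoot_mul :
    ∀ᵐ A ∂Measure.pi (fun _ : Fin k => U), ∀ᵐ z ∂U,
      ∑ i : Fin (k + 1), removalTerm 1 (circleRoot (k + 1) i * z) A = 1 := by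
  have hmeas : Measurable fun p : (Fin k → Circle) × Circle =>
      ∑ i : Fin (k + 1), removalTerm 1 (circleRoot (k + 1) i * p.2) p.1 :=
    Finset.measurable_fun_sum _ fun i _ =>
      measurable_removalTerm (measurable_snd.const_mul _) measurable_fst measurable_one
  have hone := lintegral_sum_removalTerm_one (k := k) U
  rw [lintegral_sum_removeNth U (fun i => circleRoot (k + 1) i)
    (measurable_removalTerm measurable_fst measurable_snd measurable_one),
    ← lintegral_prod _ hmeas.aemeasurable] at hone
  exact Measure.ae_ae_of_ae_prod <| ae_eq_of_ae_le_of_lintegral_le (g := fun _ => 1)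
    (.of_forall fun p => sum_removalTerm_one_circleRoot_mul_le p.1 p.2) (by simp [hone])
    aemeasurable_const (by simp [hone])

theorem lintegral_thin_mark_binomialLaw {f : SimplePointMeasure Circle × Circle → ℝ≥0∞}
    (hf : Measurable f) :
    ∫⁻ ν, f (thin ν, mark ν) ∂binomialLaw U (k + 1) =
      ∫⁻ A, ∫⁻ z, f (ofFn A, (∏ l, A l / z) ^ (k + 1)) ∂U ∂Measure.pi (fun _ : Fin k => U) := by
  have hfm : Measurable fun ν => f (thin ν, mark ν) :=
    hf.comp (measurable_thin.prodMk measurable_mark)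
  rw [binomialLaw, lintegral_map hfm (measurable_ofFn _)]
  calc _ = ∫⁻ x, ∑ i : Fin (k + 1), removalTerm f (x i) (i.removeNth x)
        ∂Measure.pi (fun _ => U) := lintegral_congr_ae <| by
        filter_upwards [ae_injective_pi U (k + 1), ae_sum_removalTerm_one_removeNth U]
          with x hx hsum using apply_thin_mark_ofFn hx hsum f
    _ = ∫⁻ A, ∫⁻ z, ∑ i : Fin (k + 1), removalTerm f (circleRoot (k + 1) i * z) A ∂U
        ∂Measure.pi (fun _ => U) :=
        lintegral_sum_removeNth U _ (measurable_removalTerm measurable_fst measurable_snd hf)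
    _ = _ := lintegral_congr_ae <| (ae_sum_removalTerm_one_circleRoot_mul U).mono fun A hA =>
        lintegral_congr_ae <| hA.mono fun z hsum => sum_removalTerm_circleRoot_mul hsum f

theorem map_thin_binomialLaw : (binomialLaw U (k + 1)).map thin = binomialLaw U k := by
  ext s hs
  have hind : Measurable (s.indicator (1 : SimplePointMeasure Circle → ℝ≥0∞)) :=
    measurable_one.indicator hs
  rw [← lintegral_indicator_one hs, ← lintegral_indicator_one hs,
    lintegral_map hind measurable_thin,
    lintegral_thin_mark_binomialLaw U (f := fun p => s.indicator 1 p.1) (hind.comp measurable_fst),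
    binomialLaw, lintegral_map hind (measurable_ofFn k)]
  simp

theorem map_iterate_thin_binomialLaw (j : ℕ) :
    (binomialLaw U (k + j)).map thin^[j] = binomialLaw U k := by
  induction j with
  | zero => exact Measure.map_id
  | succ j ih =>
    rw [Function.iterate_succ, ← Measure.map_map (measurable_thin.iterate j) measurable_thin,
      ← add_assoc, map_thin_binomialLaw, ih]

theorem map_thin_mark_binomialLaw (hk : k ≠ 0) :
    (binomialLaw U (k + 1)).map (fun ν => (thin ν, mark ν)) = (binomialLaw U k).prod U := by
  ext s hs
  have hind : Measurable (s.indicator (1 : SimplePointMeasure Circle × Circle → ℝ≥0∞)) :=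
    measurable_one.indicator hs
  rw [← lintegral_indicator_one hs, ← lintegral_indicator_one hs,
    lintegral_map hind (measurable_thin.prodMk measurable_mark),
    lintegral_thin_mark_binomialLaw U hind, lintegral_prod _ hind.aemeasurable, binomialLaw,
    lintegral_map hind.lintegral_prod_right' (measurable_ofFn k)]
  refine lintegral_congr fun A => ?_
  simp only [Finset.prod_div_distrib, Finset.prod_const, Finset.card_univ, Fintype.card_fin,
    div_pow, ← pow_mul]
  exact (measurePreserving_div_pow U _ (mul_ne_zero hk k.succ_ne_zero)).lintegral_comp
    (hind.comp measurable_prodMk_left)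

end Removal

end SimplePointMeasure

section Coupling

/-- The quantile function of weights on `ℕ` whose partial sums are `G`, where `G m` is the total
weight of the values *strictly* smaller than `m`. -/
noncomputable def quantile (G : ℕ → ℝ) (v : ℝ) : ℕ := sInf {m | v < G (m + 1)}

section Quantile

variable {G : ℕ → ℝ} {v : ℝ} {m : ℕ}

theorem quantile_le (h : v < G (m + 1)) : quantile G v ≤ m := Nat.sInf_le h

theorem quantile_eq_of_mem_Ico (hG : Monotone G) (hv : v ∈ Set.Ico (G m) (G (m + 1))) :
    quantile G v = m := by
  refine (quantile_le hv.2).antisymm (le_csInf ⟨m, hv.2⟩ fun j (hj : v < G (j + 1)) => ?_)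
  by_contra! hjm
  exact (hj.trans_le (hG hjm)).not_ge hv.1

theorem measurable_quantile : Measurable (quantile G) := by
  refine measurable_of_Iic fun n => ?_
  have hpre : quantile G ⁻¹' Set.Iic n =
      (⋃ m ≤ n, Set.Iio (G (m + 1))) ∪ ⋂ m, Set.Ici (G (m + 1)) := by
    ext v
    simp only [Set.mem_preimage, Set.mem_Iic, Set.mem_union, Set.mem_iUnion, Set.mem_Iio,
      Set.mem_iInter, Set.mem_Ici, exists_prop]
    rcases Set.eq_empty_or_nonempty {m | v < G (m + 1)} with hempty | hne
    · simp only [Set.eq_empty_iff_forall_notMem, Set.mem_ofPred_eq, not_lt] at hempty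
      simp [quantile, hempty, not_lt.2 (hempty _)]
    · have hmem : v < G (quantile G v + 1) := Nat.sInf_mem hne
      refine ⟨fun h => Or.inl ⟨_, h, hmem⟩, ?_⟩
      rintro (⟨m, hmn, hm⟩ | hall)
      · exact (quantile_le hm).trans hmn
      · exact absurd hmem (hall _).not_gt
  rw [hpre]
  measurability

end Quantile

variable (a b : ℝ≥0) (k : ℕ)

/-- The partial sums of the weights `P(Y = m) - P(X = m)` for `m ≤ k` and `P(Y = m)` for `m > k`,
where `X` and `Y` are Poisson variables with means `a` and `b`, starting from `P(X ≤ k)`: what is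
left of the law of `Y` once the values at most `k` of `X` have been matched with themselves. -/
noncomputable def residualCdf (m : ℕ) : ℝ :=
  poissonCdf b m + (poissonCdf a (k + 1) - poissonCdf a (min m (k + 1)))

theorem residualCdf_zero : residualCdf a b k 0 = poissonCdf a (k + 1) := by
  simp [residualCdf, poissonCdf]

theorem residualCdf_of_lt {m : ℕ} (h : k < m) : residualCdf a b k m = poissonCdf b m := by
  rw [residualCdf, min_eq_right h, sub_self, add_zero]

theorem residualCdf_succ_of_le {m : ℕ} (h : m ≤ k) :
    residualCdf a b k (m + 1) = residualCdf a b k m + (poissonProb b m - poissonProb a m) := by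
  rw [residualCdf, residualCdf, min_eq_left (by omega), min_eq_left (by omega), poissonCdf_succ b,
    poissonCdf_succ a m]
  ring

/-- A coupling of the Poisson laws with means `a` and `b`: for `v` uniform on `[0, 1)`, the quantile
of `v` for the mean `a` has the former law and `keepCount a b k v` the latter. That quantile is kept
if it is at most `k`; otherwise it is replaced by the quantile for the residual weights. -/
noncomputable def keepCount (v : ℝ) : ℕ :=
  if v < poissonCdf a (k + 1) then quantile (poissonCdf a) v else quantile (residualCdf a b k) v

theorem measurable_keepCount : Measurable (keepCount a b k) := by
  unfold keepCount
  exact .ite measurableSet_Iio measurable_quantile measurable_quantile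

variable {a b k} {m n : ℕ} {v : ℝ}

theorem residualCdf_mono (h : ∀ m ≤ k, poissonProb a m ≤ poissonProb b m) :
    Monotone (residualCdf a b k) := by
  refine monotone_nat_of_le_succ fun m => ?_
  rcases le_or_gt m k with hm | hm
  · rw [residualCdf_succ_of_le _ _ _ hm]
    linarith [h m hm]
  · rw [residualCdf_of_lt _ _ _ hm, residualCdf_of_lt _ _ _ (hm.trans m.lt_succ_self)]
    exact poissonCdf_mono b m.le_succ

theorem keepCount_of_le (hn : n ≤ k) (hv : v ∈ Set.Ico (poissonCdf a n) (poissonCdf a (n + 1))) :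
    keepCount a b k v = n := by
  rw [keepCount, if_pos (hv.2.trans_le (poissonCdf_mono a (Nat.succ_le_succ hn))),
    quantile_eq_of_mem_Ico (poissonCdf_mono a) hv]

theorem keepCount_lt (hb : 0 < b) (hab : b < a)
    (hcdf : poissonCdf a (k + 2) ≤ poissonCdf b (k + 1)) (hn : k < n)
    (hv : v ∈ Set.Ico (poissonCdf a n) (poissonCdf a (n + 1))) : keepCount a b k v < n := by
  obtain ⟨n, rfl⟩ := Nat.exists_eq_succ_of_ne_zero (Nat.ne_zero_of_lt hn)
  rw [keepCount, if_neg ((poissonCdf_mono a hn).trans hv.1).not_gt, Nat.lt_succ_iff]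
  refine quantile_le ?_
  rw [residualCdf_of_lt _ _ _ hn]
  exact hv.2.trans_le (poissonCdf_succ_le_of_le hb hab hn hcdf)

theorem keepCount_of_mem_residual (h : ∀ m ≤ k, poissonProb a m ≤ poissonProb b m)
    (hv : v ∈ Set.Ico (residualCdf a b k m) (residualCdf a b k (m + 1))) :
    keepCount a b k v = m := by
  have hle : poissonCdf a (k + 1) ≤ v := by
    rw [← residualCdf_zero a b k]
    exact (residualCdf_mono h m.zero_le).trans hv.1
  rw [keepCount, if_neg hle.not_gt, quantile_eq_of_mem_Ico (residualCdf_mono h) hv]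

theorem residualCdf_nonneg (h : ∀ m ≤ k, poissonProb a m ≤ poissonProb b m) (m : ℕ) :
    0 ≤ residualCdf a b k m :=
  (poissonCdf_nonneg a (k + 1)).trans
    ((residualCdf_zero a b k).ge.trans (residualCdf_mono h m.zero_le))

theorem residualCdf_le_one (h : ∀ m ≤ k, poissonProb a m ≤ poissonProb b m) (m : ℕ) :
    residualCdf a b k m ≤ 1 := by
  refine (residualCdf_mono h (le_max_left m (k + 1))).trans ?_
  rw [residualCdf_of_lt _ _ _ (lt_max_of_lt_right k.lt_succ_self)]
  exact poissonCdf_le_one b _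

theorem ofReal_poissonProb_le_volume_keepCount
    (h : ∀ m ≤ k, poissonProb a m ≤ poissonProb b m) (m : ℕ) :
    ENNReal.ofReal (poissonProb b m) ≤
      volume (keepCount a b k ⁻¹' {m} ∩ Set.Ico 0 1) := by
  have hresidual : Set.Ico (residualCdf a b k m) (residualCdf a b k (m + 1)) ⊆
      keepCount a b k ⁻¹' {m} ∩ Set.Ico 0 1 := fun v hv =>
    ⟨keepCount_of_mem_residual h hv, (residualCdf_nonneg h m).trans hv.1,
      hv.2.trans_le (residualCdf_le_one h _)⟩
  rcases le_or_gt m k with hm | hm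
  · have hmatched : Set.Ico (poissonCdf a m) (poissonCdf a (m + 1)) ⊆
        keepCount a b k ⁻¹' {m} ∩ Set.Ico 0 1 := fun v hv =>
      ⟨keepCount_of_le hm hv, (poissonCdf_nonneg a m).trans hv.1,
        hv.2.trans_le (poissonCdf_le_one a _)⟩
    have hdisj : Disjoint (Set.Ico (poissonCdf a m) (poissonCdf a (m + 1)))
        (Set.Ico (residualCdf a b k m) (residualCdf a b k (m + 1))) := by
      refine Set.Ico_disjoint_Ico.2 ((min_le_left _ _).trans (le_max_of_le_right ?_))
      exact (poissonCdf_mono a (Nat.succ_le_succ hm)).trans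
        ((residualCdf_zero a b k).ge.trans (residualCdf_mono h m.zero_le))
    refine le_of_eq_of_le ?_ (measure_mono (Set.union_subset hmatched hresidual))
    rw [measure_union hdisj measurableSet_Ico, Real.volume_Ico, Real.volume_Ico, poissonCdf_succ,
      residualCdf_succ_of_le _ _ _ hm, add_sub_cancel_left, add_sub_cancel_left,
      ← ENNReal.ofReal_add (poissonProb_nonneg a m) (sub_nonneg.2 (h m hm)), add_sub_cancel]
  · refine le_of_eq_of_le ?_ (measure_mono hresidual)
    rw [Real.volume_Ico, residualCdf_of_lt _ _ _ hm,
      residualCdf_of_lt _ _ _ (hm.trans m.lt_succ_self), poissonCdf_succ, add_sub_cancel_left]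

theorem map_keepCount (h : ∀ m ≤ k, poissonProb a m ≤ poissonProb b m) :
    (volume.restrict (Set.Ico 0 1)).map (keepCount a b k) = poissonMeasure b := by
  have : IsProbabilityMeasure ((volume : Measure ℝ).restrict (Set.Ico 0 1)) := ⟨by simp⟩
  have := Measure.isProbabilityMeasure_map (μ := (volume : Measure ℝ).restrict (Set.Ico 0 1))
    (measurable_keepCount a b k).aemeasurable
  refine (Measure.eq_of_le_of_isProbabilityMeasure (Measure.le_iff.2 fun s hs => ?_)).symm
  rw [← lintegral_indicator_one hs, ← lintegral_indicator_one hs, lintegral_countable',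
    lintegral_countable']
  refine ENNReal.tsum_le_tsum fun m => mul_le_mul_right ?_ _
  rw [← ofReal_poissonProb, Measure.map_apply (measurable_keepCount a b k) (.singleton m),
    Measure.restrict_apply (measurable_keepCount a b k (.singleton m))]
  exact ofReal_poissonProb_le_volume_keepCount h m

theorem iUnion_Ico_poissonCdf (a : ℝ≥0) :
    ⋃ n, Set.Ico (poissonCdf a n) (poissonCdf a (n + 1)) = Set.Ico 0 1 := by
  classical
  refine subset_antisymm (Set.iUnion_subset fun n => Set.Ico_subset_Ico (poissonCdf_nonneg a n)
    (poissonCdf_le_one a _)) fun v hv => ?_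
  have hex : ∃ n, v < poissonCdf a (n + 1) :=
    (((tendsto_poissonCdf a).comp (Filter.tendsto_add_atTop_nat 1)).eventually
      (lt_mem_nhds hv.2)).exists
  refine Set.mem_iUnion.2 ⟨Nat.find hex, ?_, Nat.find_spec hex⟩
  cases hn : Nat.find hex with
  | zero => simpa [poissonCdf] using hv.1
  | succ n => exact not_lt.1 (Nat.find_min hex (by omega))

theorem setLIntegral_Ico_add (c : ℝ) {p : ℝ} (hp : 0 < p) (φ : ℝ → ℝ≥0∞) :
    ∫⁻ v in Set.Ico c (c + p), φ v = ENNReal.ofReal p * ∫⁻ t in Set.Ico 0 1, φ (c + p * t) := by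
  have himage : (fun t => c + p * t) '' Set.Ico 0 1 = Set.Ico c (c + p) := by
    simpa [add_comm] using Set.image_affine_Ico hp c 0 1
  rw [← himage, lintegral_image_eq_lintegral_abs_deriv_mul (f' := fun _ => p) measurableSet_Ico
    (fun t _ => by simpa using (((hasDerivAt_id t).const_mul p).const_add c).hasDerivWithinAt)
    (fun s _ t _ hst => by simpa [hp.ne'] using hst), abs_of_pos hp,
    lintegral_const_mul' _ _ ENNReal.ofReal_ne_top]

theorem poissonCdf_add_mem_Ico (ha : 0 < a) (n : ℕ) {t : ℝ} (ht : t ∈ Set.Ico 0 1) :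
    poissonCdf a n + poissonProb a n * t ∈ Set.Ico (poissonCdf a n) (poissonCdf a (n + 1)) := by
  have hp := poissonProb_pos ha n
  rw [poissonCdf_succ]
  exact ⟨le_add_of_nonneg_right (mul_nonneg hp.le ht.1),
    by gcongr; exact mul_lt_of_lt_one_right hp ht.2⟩

theorem lintegral_poissonCdf_add (ha : 0 < a) (φ : ℝ → ℝ≥0∞) :
    ∫⁻ n, (∫⁻ t in Set.Ico 0 1, φ (poissonCdf a n + poissonProb a n * t)) ∂poissonMeasure a =
      ∫⁻ v in Set.Ico 0 1, φ v := by
  have hdisj : Pairwise (Function.onFun Disjoint fun n =>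
      Set.Ico (poissonCdf a n) (poissonCdf a (n + 1))) :=
    (poissonCdf_mono a).pairwise_disjoint_on_Ico_succ
  conv_rhs => rw [← iUnion_Ico_poissonCdf a, lintegral_iUnion (fun _ => measurableSet_Ico) hdisj]
  rw [lintegral_countable']
  refine tsum_congr fun n => ?_
  rw [poissonCdf_succ, setLIntegral_Ico_add _ (poissonProb_pos ha n), ofReal_poissonProb, mul_comm]

end Coupling

section MarkThinning

namespace SimplePointMeasure

/-- The rotation-equivariant thinning which reads off a uniform variable `t` from the mark of a
configuration of `n` points and deletes `n - κ n t` points one at a time. -/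
noncomputable def markThinning (κ : ℕ → ℝ → ℕ) (ν : SimplePointMeasure Circle) :
    SimplePointMeasure Circle :=
  thin^[ν.count Set.univ - κ (ν.count Set.univ) (circleTurn (mark ν))] ν

theorem isRotationEquivariant_markThinning (κ : ℕ → ℝ → ℕ) :
    IsRotationEquivariant (markThinning κ) := by
  intro ν θ
  rw [markThinning, markThinning, rotate_iterate_thin, count_univ_rotate, mark_rotate]

theorem points_markThinning_subset (κ : ℕ → ℝ → ℕ) (ν : SimplePointMeasure Circle) :
    (markThinning κ ν).points ⊆ ν.points := points_iterate_thin_subset _ _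

theorem measurable_iterate_thin :
    Measurable fun p : ℕ × SimplePointMeasure Circle => thin^[p.1] p.2 :=
  measurable_from_prod_countable_right measurable_thin.iterate

variable {κ : ℕ → ℝ → ℕ}

theorem measurable_markThinning (hκ : ∀ n, Measurable (κ n)) : Measurable (markThinning κ) := by
  have hN : Measurable fun ν : SimplePointMeasure Circle => ν.count Set.univ :=
    measurable_count .univ
  have hκN : Measurable fun ν : SimplePointMeasure Circle =>
      κ (ν.count Set.univ) (circleTurn (mark ν)) :=
    (measurable_from_prod_countable_right (f := fun p : ℕ × ℝ => κ p.1 p.2) hκ).comp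
      (hN.prodMk (measurable_circleTurn.comp measurable_mark))
  exact measurable_iterate_thin.comp ((hN.sub hκN).prodMk measurable_id)

variable (U : Measure Circle) [U.IsHaarMeasure] [IsProbabilityMeasure U]

theorem map_markThinning_binomialLaw_of_const {m n : ℕ} (hmn : m ≤ n)
    (hκ : ∀ t ∈ Set.Ico 0 1, κ n t = m) :
    (binomialLaw U n).map (markThinning κ) = binomialLaw U m := by
  conv_rhs => rw [← map_iterate_thin_binomialLaw U (k := m) (n - m), Nat.add_sub_cancel' hmn]
  refine Measure.map_congr ((ae_count_univ_binomialLaw U n).mono fun ν hν => ?_)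
  rw [markThinning, hν, hκ _ ⟨circleTurn_nonneg _, circleTurn_lt_one _⟩]

theorem binomialLaw_preimage_markThinning_of_lt (hκ : ∀ n, Measurable (κ n)) {n : ℕ}
    (hn : n ≠ 0) (hκn : ∀ t ∈ Set.Ico 0 1, κ (n + 1) t < n + 1)
    {s : Set (SimplePointMeasure Circle)} (hs : MeasurableSet s) :
    binomialLaw U (n + 1) (markThinning κ ⁻¹' s) =
      ∫⁻ t in Set.Ico 0 1, binomialLaw U (κ (n + 1) t) s := by
  have hle (z : Circle) : κ (n + 1) (circleTurn z) ≤ n :=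
    Nat.lt_succ_iff.1 (hκn _ ⟨circleTurn_nonneg z, circleTurn_lt_one z⟩)
  let g : SimplePointMeasure Circle × Circle → SimplePointMeasure Circle := fun p =>
    thin^[n - κ (n + 1) (circleTurn p.2)] p.1
  have hg : Measurable g := measurable_iterate_thin.comp ((measurable_const.sub
    ((hκ _).comp (measurable_circleTurn.comp measurable_snd))).prodMk measurable_fst)
  have hfactor : ∀ᵐ ν ∂binomialLaw U (n + 1), markThinning κ ν = g (thin ν, mark ν) :=
    (ae_count_univ_binomialLaw U (n + 1)).mono fun ν hν => by
      rw [markThinning, hν, Nat.succ_sub (hle _), Function.iterate_succ_apply]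
  have hfiber (z : Circle) : binomialLaw U n ((fun ν => (ν, z)) ⁻¹' (g ⁻¹' s)) =
      binomialLaw U (κ (n + 1) (circleTurn z)) s := by
    have hiter := map_iterate_thin_binomialLaw U (k := κ (n + 1) (circleTurn z))
      (n - κ (n + 1) (circleTurn z))
    rw [Nat.add_sub_cancel' (hle z)] at hiter
    rw [← hiter, Measure.map_apply (measurable_thin.iterate _) hs]
    rfl
  calc binomialLaw U (n + 1) (markThinning κ ⁻¹' s)
      = ((binomialLaw U (n + 1)).map fun ν => (thin ν, mark ν)) (g ⁻¹' s) := by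
        rw [Measure.map_apply (measurable_thin.prodMk measurable_mark) (hg hs)]
        refine measure_congr (hfactor.mono fun ν hν => ?_)
        exact congrArg (· ∈ s) hν
    _ = ∫⁻ z, binomialLaw U (κ (n + 1) (circleTurn z)) s ∂U := by
        rw [map_thin_mark_binomialLaw U hn, Measure.prod_apply_symm (hg hs)]
        exact lintegral_congr hfiber
    _ = ∫⁻ t in Set.Ico 0 1, binomialLaw U (κ (n + 1) t) s :=
        (measurePreserving_circleTurn U).lintegral_comp
          ((Measurable.of_discrete (f := fun m => binomialLaw U m s)).comp (hκ _))

theorem binomialLaw_preimage_markThinning (hκ : ∀ n, Measurable (κ n)) {n : ℕ}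
    (hκn : (∀ t ∈ Set.Ico 0 1, κ n t = n) ∨ ∀ t ∈ Set.Ico 0 1, κ n t < n)
    {s : Set (SimplePointMeasure Circle)} (hs : MeasurableSet s) :
    binomialLaw U n (markThinning κ ⁻¹' s) = ∫⁻ t in Set.Ico 0 1, binomialLaw U (κ n t) s := by
  have hconst {m : ℕ} (hmn : m ≤ n) (h : ∀ t ∈ Set.Ico 0 1, κ n t = m) :
      binomialLaw U n (markThinning κ ⁻¹' s) =
        ∫⁻ t in Set.Ico 0 1, binomialLaw U (κ n t) s := by
    rw [← Measure.map_apply (measurable_markThinning hκ) hs,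
      map_markThinning_binomialLaw_of_const U hmn h,
      setLIntegral_congr_fun (g := fun _ => binomialLaw U m s) measurableSet_Ico
        fun t ht => by rw [h t ht]]
    simp
  rcases hκn with heq | hlt
  · exact hconst le_rfl heq
  · match n with
    | 0 => exact absurd (hlt 0 ⟨le_rfl, one_pos⟩) (Nat.not_lt_zero _)
    | 1 => exact hconst zero_le_one fun t ht => Nat.lt_one_iff.1 (hlt t ht)
    | _ + 2 => exact binomialLaw_preimage_markThinning_of_lt U hκ (Nat.succ_ne_zero _) hlt hs

variable {a b : ℝ≥0} {k : ℕ}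

/-- The thinning which couples the numbers of points before and after it through `keepCount`: if the
former is Poisson with mean `a`, the latter is Poisson with mean `b`. -/
noncomputable def poissonThinning (a b : ℝ≥0) (k : ℕ) :
    SimplePointMeasure Circle → SimplePointMeasure Circle :=
  markThinning fun n t => keepCount a b k (poissonCdf a n + poissonProb a n * t)

theorem measurable_keepCount_add_mul (a b : ℝ≥0) (k : ℕ) (c p : ℝ) :
    Measurable fun t => keepCount a b k (c + p * t) :=
  (measurable_keepCount a b k).comp ((measurable_id.const_mul p).const_add c)

theorem measurable_poissonThinning : Measurable (poissonThinning a b k) :=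
  measurable_markThinning fun _ => measurable_keepCount_add_mul a b k _ _

theorem map_poissonThinning_poissonMixture (hb : 0 < b) (hab : b < a)
    (hprob : poissonProb a k ≤ poissonProb b k)
    (hcdf : poissonCdf a (k + 2) ≤ poissonCdf b (k + 1)) :
    (poissonMixture U a).map (poissonThinning a b k) = poissonMixture U b := by
  have ha : 0 < a := hb.trans hab
  ext s hs
  have hbin (n : ℕ) : binomialLaw U n (poissonThinning a b k ⁻¹' s) = ∫⁻ t in Set.Ico 0 1,
      binomialLaw U (keepCount a b k (poissonCdf a n + poissonProb a n * t)) s := by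
    refine binomialLaw_preimage_markThinning U
      (fun _ => measurable_keepCount_add_mul a b k _ _) ?_ hs
    rcases le_or_gt n k with hn | hn
    · exact Or.inl fun t ht => keepCount_of_le hn (poissonCdf_add_mem_Ico ha n ht)
    · exact Or.inr fun t ht => keepCount_lt hb hab hcdf hn (poissonCdf_add_mem_Ico ha n ht)
  calc (poissonMixture U a).map (poissonThinning a b k) s
      = ∫⁻ n, (∫⁻ t in Set.Ico 0 1, binomialLaw U
          (keepCount a b k (poissonCdf a n + poissonProb a n * t)) s) ∂poissonMeasure a := by
        rw [Measure.map_apply measurable_poissonThinning hs,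
          poissonMixture_apply U a (measurable_poissonThinning hs)]
        exact lintegral_congr hbin
    _ = ∫⁻ v in Set.Ico 0 1, binomialLaw U (keepCount a b k v) s :=
        lintegral_poissonCdf_add ha fun v => binomialLaw U (keepCount a b k v) s
    _ = ∫⁻ m, binomialLaw U m s ∂poissonMeasure b := by
        rw [← map_keepCount fun m hm => poissonProb_le_of_le hab hm hprob,
          lintegral_map .of_discrete (measurable_keepCount a b k)]
    _ = poissonMixture U b s := (poissonMixture_apply U b hs).symm

end SimplePointMeasure

end MarkThinning

section Equivalence

theorem exists_isHaarMeasure_isProbabilityMeasure_smul_eq {G : Type*} [Group G] [TopologicalSpace G]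
    [MeasurableSpace G] [BorelSpace G] [IsTopologicalGroup G] (σ : Measure G) [σ.IsHaarMeasure]
    [IsFiniteMeasure σ] : ∃ U : Measure G, U.IsHaarMeasure ∧ IsProbabilityMeasure U ∧
      ∀ c : ℝ≥0, c • σ = (c * (σ Set.univ).toNNReal) • U := by
  have hσ0 : σ Set.univ ≠ 0 := isOpen_univ.measure_ne_zero σ Set.univ_nonempty
  have hσt : σ Set.univ ≠ ∞ := measure_ne_top _ _
  refine ⟨(σ Set.univ)⁻¹ • σ,
    .smul σ (ENNReal.inv_ne_zero.2 hσt) (ENNReal.inv_ne_top.2 hσ0),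
    ⟨ENNReal.inv_mul_cancel hσ0 hσt⟩, fun c => ?_⟩
  rw [mul_smul, ENNReal.smul_def (σ Set.univ).toNNReal, ENNReal.coe_toNNReal hσt, smul_smul,
    ENNReal.mul_inv_cancel hσ0 hσt, one_smul]

section HasLaw

variable {Ω : Type*} [MeasurableSpace Ω] {Q : Measure Ω} {X : Ω → ℕ} {a : ℝ≥0}

theorem measure_eq_of_hasLaw_poissonMeasure (hX : HasLaw X (poissonMeasure a) Q) (k : ℕ) :
    Q {ω | X ω = k} = ENNReal.ofReal (poissonProb a k) := by
  rw [hX.measure_eq (p := (· = k)) (.singleton k), ofReal_poissonProb]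
  rfl

theorem measure_le_of_hasLaw_poissonMeasure (hX : HasLaw X (poissonMeasure a) Q) (k : ℕ) :
    Q {ω | X ω ≤ k} = ENNReal.ofReal (poissonCdf a (k + 1)) := by
  rw [hX.measure_eq (p := (· ≤ k)) measurableSet_Iic, ← poissonMeasure_real_Iio,
    ofReal_measureReal, ← Order.succ_eq_add_one, Set.Iio_succ_eq_Iic]
  rfl

end HasLaw

theorem exists_rotationEquivariant_thinning {Ω : Type*} [MeasurableSpace Ω] {P : Measure Ω}
    [IsProbabilityMeasure P] {U : Measure Circle} [U.IsHaarMeasure] [IsProbabilityMeasure U]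
    {a b : ℝ≥0} (hb : 0 < b) (hab : b < a) {ξ : Ω → SimplePointMeasure Circle}
    (hξ : IsPoissonProcess P (a • U) ξ) {k : ℕ} (hprob : poissonProb a k ≤ poissonProb b k)
    (hcdf : poissonCdf a (k + 2) ≤ poissonCdf b (k + 1)) :
    ∃ f : SimplePointMeasure Circle → SimplePointMeasure Circle,
      Measurable f ∧ IsRotationEquivariant f ∧ IsPoissonProcess P (b • U) (fun ω => f (ξ ω)) ∧
      ∀ᵐ ω ∂P, (f (ξ ω)).points ⊆ (ξ ω).points := by
  have hf : Measurable (SimplePointMeasure.poissonThinning a b k) :=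
    SimplePointMeasure.measurable_poissonThinning
  have hfξ : P.map (fun ω => SimplePointMeasure.poissonThinning a b k (ξ ω)) =
      poissonMixture U b := by
    rw [← SimplePointMeasure.map_poissonThinning_poissonMixture U hb hab hprob hcdf,
      ← hξ.map_eq_poissonMixture, Measure.map_map hf hξ.measurable]
    rfl
  exact ⟨_, hf, SimplePointMeasure.isRotationEquivariant_markThinning _,
    isPoissonProcess_of_map_eq_poissonMixture (hf.comp hξ.measurable) hfξ,
    ae_of_all _ fun _ => SimplePointMeasure.points_markThinning_subset _ _⟩

end Equivalence

/-- `σ` ranges over all normalizations of the uniform measure on the circle: the nonzero finite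
rotation-invariant Borel measures. -/
theorem mainTheorem6
    (σ : Measure Circle) [σ.IsHaarMeasure]
    (lam mu : ℝ≥0) (hmu : 0 < mu) (hlam : mu < lam)
    {Ω : Type*} [MeasurableSpace Ω] (P : Measure Ω) [IsProbabilityMeasure P]
    (ξ : Ω → SimplePointMeasure Circle) (hξ : IsPoissonProcess P (lam • σ) ξ)
    {Ω' : Type*} [MeasurableSpace Ω'] (Q : Measure Ω') [IsProbabilityMeasure Q]
    (X Y : Ω' → ℕ)
    (hX : HasLaw X (poissonMeasure (lam * (σ Set.univ).toNNReal)) Q)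
    (hY : HasLaw Y (poissonMeasure (mu * (σ Set.univ).toNNReal)) Q) :
    List.TFAE [
      ∃ f : SimplePointMeasure Circle → SimplePointMeasure Circle,
        Measurable f ∧ IsRotationEquivariant f ∧
        IsPoissonProcess P (mu • σ) (fun ω => f (ξ ω)) ∧
        ∀ᵐ ω ∂P, (f (ξ ω)).points ⊆ (ξ ω).points,
      ∃ k : ℕ, Q {ω | X ω = k} ≤ Q {ω | Y ω = k} ∧
        Q {ω | X ω ≤ k + 1} ≤ Q {ω | Y ω ≤ k},
      ¬ ∃ k : ℕ, Q {ω | X ω = k + 1} > Q {ω | Y ω = k + 1} ∧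
        Q {ω | X ω ≤ k + 1} > Q {ω | Y ω ≤ k}] := by
  obtain ⟨U, hUh, hUp, hscale⟩ := exists_isHaarMeasure_isProbabilityMeasure_smul_eq σ
  have hσ : 0 < (σ Set.univ).toNNReal := ENNReal.toNNReal_pos (NeZero.ne _) (measure_ne_top _ _)
  set a := lam * (σ Set.univ).toNNReal
  set b := mu * (σ Set.univ).toNNReal
  have hb : 0 < b := mul_pos hmu hσ
  have hab : b < a := mul_lt_mul_of_pos_right hlam hσ
  replace hξ : IsPoissonProcess P (a • U) ξ := hξ.congr (hscale lam)
  simp only [measure_eq_of_hasLaw_poissonMeasure hX, measure_eq_of_hasLaw_poissonMeasure hY,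
    measure_le_of_hasLaw_poissonMeasure hX, measure_le_of_hasLaw_poissonMeasure hY, gt_iff_lt,
    ENNReal.ofReal_le_ofReal_iff (poissonProb_nonneg _ _),
    ENNReal.ofReal_le_ofReal_iff (poissonCdf_nonneg _ _),
    ENNReal.ofReal_lt_ofReal_iff_of_nonneg (poissonProb_nonneg _ _),
    ENNReal.ofReal_lt_ofReal_iff_of_nonneg (poissonCdf_nonneg _ _)]
  tfae_have 1 → 3 := by
    rintro ⟨f, hf, -, hfξ, hsub⟩ ⟨k, hprob, hcdf⟩
    exact hcdf.not_ge (hξ.poissonCdf_succ_le hf (hfξ.congr (hscale mu)) hsub hprob)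
  tfae_have 2 ↔ 3 := exists_poissonProb_le_iff hb hab
  tfae_have 2 → 1 := by
    rintro ⟨k, hprob, hcdf⟩
    obtain ⟨f, hf, hrot, hfξ, hsub⟩ := exists_rotationEquivariant_thinning hb hab hξ hprob hcdf
    exact ⟨f, hf, hrot, hfξ.congr (hscale mu).symm, hsub⟩
  tfae_finish
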